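/- Let $X$ be a complex Banach space and let $-A$ be the generator of a bounded $C_0$-semigroup $(T(s))_{s\ge 0}$ on $X$. For $t>0$ and $x\in X$ put $$C_t(A)x := \frac1t\int_0^t T(s)x\,ds .$$ Let $\alpha\in(0,1)$, and let $A^\alpha=f(A)$ be the fractional power of $A$, where $f(z)=z^\alpha$ (principal branch), defined by the extended Hille--Phillips calculus: for bounded complex Borel measures $\mu,\nu$ on $[0,\infty)$ whose Laplace transforms $\hat\mu(z)=\int e^{-sz}\mu(ds)$, $\hat\nu$ satisfy $\hat\nu=\hat\mu f$ on $\{\operatorname{Re} z>0\}$, and such that the operator $\hat\mu(A):=\int T(s)\,\mu(ds)$ is injective, $f(A):=\hat\mu(A)^{-1}\hat\nu(A)$ with its natural domain $\{x:\hat\nu(A)x\in\operatorname{ran}\hat\mu(A)\}$ (this does not depend on the choice of $\mu,\nu$). Then: (a) For each $x\in\operatorname{ran}(A^\alpha)$, $\|C_t(A)x\|=O(t^{-\alpha})$ as $t\to\infty$. (b) If the semigroup is mean ergodic, i.e. $X=\ker(A)\oplus\overline{\operatorname{ran}}(A)$, then for each $x\in\operatorname{ran}(A^\alpha)$, $\|C_t(A)x\|=o(t^{-\alpha})$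 as $t\to\infty$. (c) If $0$ is an accumulation point of the spectrum $\sigma(A)$, then for every decreasing (not necessarily strictly) function $\epsilon:(0,\infty)\to(0,\infty)$ with $\lim_{t\to\infty}\epsilon(t)=0$ there exists $y\in\operatorname{ran}(A^\alpha)$ such that $$\sup_{t\ge 1}\frac{t^\alpha\|C_t(A)y\|}{\epsilon(t)}=\infty .$$ -/

import Mathlib

open Filter Topology MeasureTheory Asymptotics
open scoped NNReal

noncomputable section

/-- A strongly continuous one-parameter semigroup (`C₀`-semigroup) of bounded linear operators on a
complex normed space `X`. -/
structure C0Semigroup (X : Type*) [NormedAddCommGroup X] [NormedSpace ℂ X] where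
  /-- The operator `T(s)`, for `s ≥ 0`. -/
  op : ℝ≥0 → X →L[ℂ] X
  op_zero : op 0 = 1
  op_add : ∀ s t, op (s + t) = op s * op t
  strongly_continuous : ∀ x, Continuous fun s => op s x

namespace C0Semigroup

variable {X : Type*} [NormedAddCommGroup X] [NormedSpace ℂ X] (T : C0Semigroup X)

/-- The semigroup is bounded: `sup_{s ≥ 0} ‖T(s)‖ < ∞`. -/
def IsBounded : Prop := ∃ M : ℝ, ∀ s, ‖T.op s‖ ≤ M

/-- `y` is the derivative at `0` from the right of the orbit `s ↦ T(s)x`. -/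
def HasOrbitDeriv (x y : X) : Prop :=
  Tendsto (fun h : ℝ => h⁻¹ • (T.op h.toNNReal x - x)) (𝓝[>] 0) (𝓝 y)

variable {T} in
theorem HasOrbitDeriv.add {x x' y y' : X} (h : T.HasOrbitDeriv x y) (h' : T.HasOrbitDeriv x' y') :
    T.HasOrbitDeriv (x + x') (y + y') := by
  refine (Tendsto.add h h').congr fun t => ?_
  rw [map_add, ← smul_add]
  congr 1
  abel

variable {T} in
theorem HasOrbitDeriv.smul {x y : X} (h : T.HasOrbitDeriv x y) (c : ℂ) :
    T.HasOrbitDeriv (c • x) (c • y) := by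
  refine (Tendsto.const_smul h c).congr fun t => ?_
  rw [map_smul, ← smul_sub, smul_comm]

/-- The infinitesimal generator of the semigroup: its domain consists of the `x` for which
`lim_{h ↓ 0} (T(h)x - x)/h` exists in `X`, and its value at `x` is this limit. -/
def generator : X →ₗ.[ℂ] X where
  domain :=
    { carrier := {x | ∃ y, T.HasOrbitDeriv x y}
      add_mem' := fun ⟨_, h⟩ ⟨_, h'⟩ => ⟨_, h.add h'⟩
      zero_mem' := ⟨0, by simp [HasOrbitDeriv]⟩
      smul_mem' := fun c _ ⟨_, h⟩ => ⟨_, h.smul c⟩ }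
  toFun :=
    { toFun := fun x => x.2.choose
      map_add' := fun x x' => tendsto_nhds_unique (x + x').2.choose_spec
        (x.2.choose_spec.add x'.2.choose_spec)
      map_smul' := fun c x => tendsto_nhds_unique (c • x).2.choose_spec
        (x.2.choose_spec.smul c) }

/-- `(x, y)` lies in the graph of the generator iff `y = lim_{h ↓ 0} (T(h)x - x)/h`. -/
theorem mem_graph_generator {x y : X} : (x, y) ∈ T.generator.graph ↔ T.HasOrbitDeriv x y := by
  rw [LinearPMap.mem_graph_iff]
  constructor
  · rintro ⟨⟨x', hx'⟩, rfl, rfl⟩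
    exact hx'.choose_spec
  · intro h
    exact ⟨⟨x, y, h⟩, rfl, tendsto_nhds_unique (Exists.choose_spec (⟨y, h⟩ : ∃ y, _)) h⟩

/-- The Cesàro average `C_t x = (1/t) ∫_0^t T(s)x ds`, for `t > 0`. -/
def cesaro (t : ℝ) (x : X) : X := t⁻¹ • ∫ s in (0 : ℝ)..t, T.op s.toNNReal x

/-- The Hille-Phillips calculus: `∫ T(s)x μ(ds)` for a complex measure `μ` on `[0, ∞)`. If `-A`
generates `T`, this is `g(A)x` where `g` is the Laplace transform of `μ`. -/
def hillePhillips (μ : ComplexMeasure ℝ≥0) (x : X) : X :=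
  VectorMeasure.integral μ (fun s => T.op s x) (ContinuousLinearMap.lsmul ℝ ℂ).flip

end C0Semigroup

/-- The Laplace transform `∫ e^{-sz} μ(ds)` of a complex measure `μ` on `[0, ∞)`, for `Re z > 0`. -/
def laplaceTransform (μ : ComplexMeasure ℝ≥0) (z : ℂ) : ℂ :=
  VectorMeasure.integral μ (fun s : ℝ≥0 => Complex.exp (-((s : ℝ) : ℂ) * z))
    (ContinuousLinearMap.mul ℝ ℂ)

namespace C0Semigroup

variable {X : Type*} [NormedAddCommGroup X] [NormedSpace ℂ X] (T : C0Semigroup X)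

/-- The Laplace transform `e` of `μ` is a regularizer for `f`, with `e f` the Laplace transform of
`ν` on the open right half-plane and `e(A)` injective. -/
structure IsRegularizer (f : ℂ → ℂ) (μ ν : ComplexMeasure ℝ≥0) : Prop where
  laplace_eq : ∀ z : ℂ, 0 < z.re → laplaceTransform ν z = laplaceTransform μ z * f z
  injective : Function.Injective (T.hillePhillips μ)

/-- The graph of `f(A) = e(A)⁻¹ (e f)(A)` in the extended Hille-Phillips calculus, where `-A`
generates the bounded semigroup `T` and `f` is a holomorphic function on the open right half-plane:
`x` is in the domain and `f(A)x = y` iff `(e f)(A)x = e(A)y` for a regularizer `e` of `f`. (The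
operator does not depend on the regularizer.) -/
def extendedCalculusGraph (f : ℂ → ℂ) : Set (X × X) :=
  {p | ∃ μ ν : ComplexMeasure ℝ≥0,
    T.IsRegularizer f μ ν ∧ T.hillePhillips ν p.1 = T.hillePhillips μ p.2}

/-- The range of the fractional power `A^α`, where `-A` generates the bounded semigroup `T` and
`A^α = f(A)` for `f(z) = z^α` (principal branch). -/
def fractionalPowerRange (α : ℝ) : Set X :=
  {y | ∃ x, (x, y) ∈ T.extendedCalculusGraph fun z : ℂ => z ^ (α : ℂ)}

end C0Semigroup

namespace LinearPMap

variable {X : Type*} [NormedAddCommGroup X] [NormedSpace ℂ X] (A : X →ₗ.[ℂ] X)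

/-- The spectrum of an unbounded operator `A`: the `z` for which `z - A`, as a map from the domain
of `A` to `X`, has no bounded two-sided inverse. -/
def unboundedSpectrum : Set ℂ :=
  {z | ¬ ∃ R : X →L[ℂ] X,
    (∀ x : X, ∃ h : R x ∈ A.domain, z • R x - A ⟨R x, h⟩ = x) ∧
    (∀ x : A.domain, R (z • (x : X) - A x) = x)}

/-- The kernel of `A`, as a subspace of `X`. -/
def kernel : Submodule ℂ X := (LinearMap.ker A.toFun).map A.domain.subtype

/-- Mean ergodicity of the bounded semigroup generated by `-A`: `X` is the direct sum of the kernel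
of `A` and of the closure of the range of `A`. -/
def IsMeanErgodic : Prop := IsCompl A.kernel (LinearMap.range A.toFun).topologicalClosure

end LinearPMap

end

/-! Write `p(s) = s^(-α)` on `(0, ∞)` and `k_t(s) = p(s) - p(s - t)`. The Laplace transform of `k_t`
is `Γ(1-α) z^(α-1) (1 - e^(-tz))`, which is `tΓ(1-α)` times `z^α · (1 - e^(-tz))/(tz)`, and the last
factor is the transform of the Cesàro kernel. Hence `x = A^α u` gives `C_t x = (tΓ(1-α))⁻¹ ∫ k_t(s)
T(s)u ds` (`cesaro_eq_diffOp`); the proof cancels the injective regularizer and uses uniqueness of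
Laplace transforms.

(a) The `L¹` norm of `k_t` is `2t^(1-α)/(1-α)`.

(b) The vectors `u` with `t^(α-1) ∫ k_t(s) T(s)u ds → 0` form a closed set, by the bound from (a).
It contains `ker A`, because `∫ k_t = 0`. It contains `u - T(δ)u`, because `k_t - k_t(· - δ) = k_δ -
k_δ(· - t)` keeps the integral bounded in `t`; limits of difference quotients then give `ran A` and
its closure.

(c) If every `y` in the range satisfied the bound, Banach-Steinhaus would give `t^α ‖C_t R v(A) R‖ ≤
C ε(t)`, where `R = (1 + A)⁻¹` and `v(A) = A^α R`. Spectral inclusion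
(`norm_densityIntegral_mul_le`) bounds this norm below by the modulus of the corresponding scalar
function at any `z ∈ σ(A)`. For small `z ≠ 0` and `t = 1/(2|z|)` the left side is then at least
`1/32`, and `z → 0` in `σ(A)` contradicts `ε(t) → 0`. -/

noncomputable section

/-! ### Reduction of complex measures to finite positive measures. -/

/-- The complex measure `c • m` for a finite positive measure `m`. -/
def complexMeasureOf {Ω : Type*} [MeasurableSpace Ω] (m : Measure Ω) [IsFiniteMeasure m] (c : ℂ) :
    ComplexMeasure Ω :=
  m.toSignedMeasure.mapRange ((LinearMap.id : ℝ →ₗ[ℝ] ℝ).smulRight c).toAddMonoidHom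
    (by simpa using! continuous_id.smul continuous_const)

theorem complexMeasureOf_apply {Ω : Type*} [MeasurableSpace Ω] (m : Measure Ω) [IsFiniteMeasure m]
    (c : ℂ) (s : Set Ω) : complexMeasureOf m c s = (m.toSignedMeasure s) • c := rfl

theorem variation_complexMeasureOf_le {Ω : Type*} [MeasurableSpace Ω] (m : Measure Ω)
    [IsFiniteMeasure m] (c : ℂ) : (complexMeasureOf m c).variation ≤ ‖c‖ₑ • m := by
  refine VectorMeasure.variation_le_of_forall_enorm_le fun s hs => ?_
  rw [complexMeasureOf_apply, enorm_smul, mul_comm, Measure.smul_apply, smul_eq_mul,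
    Measure.toSignedMeasure_apply_measurable hs]
  gcongr
  rw [Measure.real, Real.enorm_of_nonneg ENNReal.toReal_nonneg,
    ENNReal.ofReal_toReal (measure_ne_top _ _)]

section

variable {Ω E : Type*} [MeasurableSpace Ω] [NormedAddCommGroup E] [NormedSpace ℂ E]

omit [NormedSpace ℂ E] in
theorem integrable_variation_complexMeasureOf {m : Measure Ω} [IsFiniteMeasure m] {c : ℂ}
    {f : Ω → E} (hf : Integrable f m) : (complexMeasureOf m c).Integrable f :=
  (hf.smul_measure (c := ‖c‖ₑ) (by simp)).mono_measure (variation_complexMeasureOf_le m c)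

/-- Both integrals are `setToFun` of a transpose, and in the transpose the scalar `c` can be moved
from the value of the measure to the integrand. What remains is an integral against the signed
measure of `m`, which is a Bochner integral. -/
theorem integral_complexMeasureOf [CompleteSpace E] {m : Measure Ω} [IsFiniteMeasure m] {c : ℂ}
    {f : Ω → E} (hf : Integrable f m) :
    VectorMeasure.integral (complexMeasureOf m c) f (ContinuousLinearMap.lsmul ℝ ℂ).flip =
      c • ∫ s, f s ∂m := by
  let B : E →L[ℝ] ℂ →L[ℝ] E := (ContinuousLinearMap.lsmul ℝ ℂ).flip
  let B' : E →L[ℝ] ℝ →L[ℝ] E := (ContinuousLinearMap.lsmul ℝ ℝ).flip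
  let C : E →L[ℝ] E := ContinuousLinearMap.lsmul ℝ ℂ c
  have hf' : m.toSignedMeasure.Integrable f := by
    simpa only [VectorMeasure.Integrable, Measure.variation_toSignedMeasure] using hf
  have hT : (complexMeasureOf m c).transpose B = fun s => m.toSignedMeasure.transpose (B' ∘L C) s := by
    funext s
    ext x
    change (m.toSignedMeasure s • c) • x = m.toSignedMeasure s • c • x
    rw [smul_assoc]
  have hd := dominatedFinMeasAdditive_cbmApplyMeasure (complexMeasureOf m c) B
  rw [hT] at hd
  calc VectorMeasure.integral (complexMeasureOf m c) f B
      = setToFun (complexMeasureOf m c).variation _ hd f := by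
        rw [VectorMeasure.integral_eq_setToFun]
        exact setToFun_congr_left _ _ hT f
    _ = VectorMeasure.integral m.toSignedMeasure f (B' ∘L C) := by
        rw [VectorMeasure.integral_eq_setToFun]
        refine (setToFun_congr_measure_of_integrable ‖c‖ₑ (by simp) ?_ _ _ f hf').symm
        rw [Measure.variation_toSignedMeasure]
        exact variation_complexMeasureOf_le m c
    _ = VectorMeasure.integral m.toSignedMeasure (fun s => c • f s) B' :=
        (VectorMeasure.integral_continuousLinearMap_comp (C := C) hf').symm
    _ = c • ∫ s, f s ∂m := by
        rw [← integral_smul]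
        exact VectorMeasure.integral_toSignedMeasure

/-- Every complex measure is a combination of four finite positive measures. -/
theorem exists_eq_complexMeasureOf (μ : ComplexMeasure Ω) :
    ∃ m₁ m₂ m₃ m₄ : Measure Ω, ∃ (_ : IsFiniteMeasure m₁) (_ : IsFiniteMeasure m₂)
      (_ : IsFiniteMeasure m₃) (_ : IsFiniteMeasure m₄),
      μ = (complexMeasureOf m₁ 1 + complexMeasureOf m₂ (-1)) +
        (complexMeasureOf m₃ Complex.I + complexMeasureOf m₄ (-Complex.I)) := by
  set a := (ComplexMeasure.re μ).toJordanDecomposition with ha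
  set b := (ComplexMeasure.im μ).toJordanDecomposition with hb
  refine ⟨a.posPart, a.negPart, b.posPart, b.negPart, inferInstance, inferInstance, inferInstance,
    inferInstance, ?_⟩
  have h1 : a.toSignedMeasure = ComplexMeasure.re μ :=
    SignedMeasure.toSignedMeasure_toJordanDecomposition _
  have h2 : b.toSignedMeasure = ComplexMeasure.im μ :=
    SignedMeasure.toSignedMeasure_toJordanDecomposition _
  ext s hs
  have e1 : (μ s).re = _ := (congrArg (fun v : SignedMeasure Ω => v s) h1).symm
  have e2 : (μ s).im = _ := (congrArg (fun v : SignedMeasure Ω => v s) h2).symm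
  simp only [JordanDecomposition.toSignedMeasure] at e1 e2
  apply Complex.ext
  · rw [e1]
    simp [complexMeasureOf_apply, sub_eq_add_neg, hs]
  · rw [e2]
    simp [complexMeasureOf_apply, sub_eq_add_neg, hs]

end

/-! ### Uniqueness of Laplace transforms of finite measures. -/

/-- The function `s ↦ e^{-zs}` on `[0, ∞)`, as a bounded continuous function. -/
def expDecay (z : ℝ≥0) : BoundedContinuousFunction ℝ≥0 ℝ :=
  BoundedContinuousFunction.ofNormedAddCommGroup (fun s : ℝ≥0 => Real.exp (-(z * s : ℝ)))
    (by fun_prop) 1 fun s => by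
      rw [Real.norm_eq_abs, Real.abs_exp, Real.exp_le_one_iff, neg_nonpos]
      positivity

theorem expDecay_apply (z s : ℝ≥0) : expDecay z s = Real.exp (-(z * s : ℝ)) := rfl

theorem expDecay_mul (z w : ℝ≥0) : expDecay z * expDecay w = expDecay (z + w) := by
  ext s
  simp only [BoundedContinuousFunction.mul_apply, expDecay_apply, ← Real.exp_add]
  congr 1
  push_cast
  ring

theorem expDecay_zero : expDecay 0 = 1 := by
  ext s
  simp [expDecay_apply]

/-- Recovers the total mass from the Laplace transform at positive points. The exponent `0` is
needed so that the exponentials form a monoid with unit. -/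
theorem tendsto_integral_expDecay (m : Measure ℝ≥0) [IsFiniteMeasure m] :
    Tendsto (fun n : ℕ => ∫ s, expDecay (1 / ((n : ℝ≥0) + 1)) s ∂m) atTop
      (𝓝 (∫ s, expDecay 0 s ∂m)) := by
  refine tendsto_integral_of_dominated_convergence (fun _ => 1)
    (fun n => (expDecay _).continuous.aestronglyMeasurable) (integrable_const _)
    (fun n => ae_of_all _ fun s => ?_) (ae_of_all _ fun s => ?_)
  · rw [expDecay_apply, Real.norm_eq_abs, Real.abs_exp, Real.exp_le_one_iff, neg_nonpos]
    positivity
  · simp only [expDecay_apply]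
    have h : Tendsto (fun n : ℕ => (((1 / ((n : ℝ≥0) + 1) : ℝ≥0)) : ℝ)) atTop (𝓝 0) := by
      simpa using tendsto_one_div_add_atTop_nhds_zero_nat (𝕜 := ℝ)
    have := ((h.mul_const (s : ℝ)).neg).rexp
    simpa using this

/-- A finite measure on `[0, ∞)` is determined by its Laplace transform on `(0, ∞)`. -/
theorem ext_of_integral_exp_neg_mul_eq {m m' : Measure ℝ≥0} [IsFiniteMeasure m]
    [IsFiniteMeasure m']
    (h : ∀ z : ℝ, 0 < z → ∫ s : ℝ≥0, Real.exp (-(z * s)) ∂m = ∫ s : ℝ≥0, Real.exp (-(z * s)) ∂m') :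
    m = m' := by
  have h' : ∀ z, ∫ s, expDecay z s ∂m = ∫ s, expDecay z s ∂m' := by
    intro z
    rcases eq_or_ne z 0 with rfl | hz
    · refine tendsto_nhds_unique (tendsto_integral_expDecay m)
        ((tendsto_integral_expDecay m').congr fun n => ?_)
      exact (h ((1 / ((n : ℝ≥0) + 1) : ℝ≥0) : ℝ) (by positivity)).symm
    · exact h z (by positivity)
  -- The exponentials are closed under products, so the algebra they generate is their linear span,
  -- on which the two integrals agree. It separates points through `e^(-s)`, so it determines finite
  -- measures on the Polish space `ℝ≥0`.
  let M : Submonoid (BoundedContinuousFunction ℝ≥0 ℝ) :=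
    { carrier := Set.range expDecay
      mul_mem' := by
        rintro _ _ ⟨z, rfl⟩ ⟨w, rfl⟩
        exact ⟨z + w, (expDecay_mul z w).symm⟩
      one_mem' := ⟨0, expDecay_zero⟩ }
  let A : StarSubalgebra ℝ (BoundedContinuousFunction ℝ≥0 ℝ) :=
    { Algebra.adjoin ℝ (M : Set (BoundedContinuousFunction ℝ≥0 ℝ)) with
      star_mem' := fun {g} hg => by
        have : star g = g := by ext s; simp
        rw [this]; exact hg }
  refine ext_of_forall_mem_subalgebra_integral_eq_of_polish (𝕜 := ℝ) (A := A) ?_ ?_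
  · intro s t hst
    refine ⟨expDecay 1, ⟨(expDecay 1).toContinuousMap, ⟨expDecay 1, ?_, rfl⟩, rfl⟩, ?_⟩
    · exact Algebra.subset_adjoin ⟨1, rfl⟩
    · simpa [expDecay_apply] using hst
  · intro g hg
    have hg' : g ∈ Submodule.span ℝ (M : Set (BoundedContinuousFunction ℝ≥0 ℝ)) := by
      have : g ∈ Subalgebra.toSubmodule (Algebra.adjoin ℝ (M : Set (BoundedContinuousFunction ℝ≥0 ℝ))) := hg
      rwa [Algebra.adjoin_eq_span, Submonoid.closure_eq] at this
    clear hg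
    induction hg' using Submodule.span_induction with
    | mem x hx => obtain ⟨z, rfl⟩ := hx; exact h' z
    | zero => simp
    | add x y _ _ hx hy =>
      simp only [BoundedContinuousFunction.add_apply]
      rw [integral_add (x.integrable _) (y.integrable _),
        integral_add (x.integrable _) (y.integrable _), hx, hy]
    | smul a x _ hx =>
      simp only [BoundedContinuousFunction.smul_apply]
      rw [integral_smul, integral_smul, hx]

/-! ### Integrable densities and their convolutions with measures. -/

/-- The positive part of the density `h` on `ℝ`, pushed forward to `[0, ∞)`. -/
def posPartMeasure (h : ℝ → ℝ) : Measure ℝ≥0 :=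
  (volume.withDensity fun s => ENNReal.ofReal (h s)).map Real.toNNReal

theorem isFiniteMeasure_posPartMeasure {h : ℝ → ℝ} (hh : Integrable h) :
    IsFiniteMeasure (posPartMeasure h) := by
  have := isFiniteMeasure_withDensity_ofReal hh.2
  exact Measure.isFiniteMeasure_map _ _

section

variable {E : Type*} [NormedAddCommGroup E] [NormedSpace ℝ E]

/-- The integral of a function on `[0, ∞)` against the real density `h`. -/
def densityIntegral (h : ℝ → ℝ) (F : ℝ≥0 → E) : E := ∫ s : ℝ, h s • F s.toNNReal

theorem integrable_smul_comp_toNNReal {h : ℝ → ℝ} (hh : Integrable h) {F : ℝ≥0 → E}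
    (hF : Continuous F) {C : ℝ} (hC : ∀ s, ‖F s‖ ≤ C) :
    Integrable fun s : ℝ => h s • F s.toNNReal := by
  refine hh.smul_bdd C ?_ (ae_of_all _ fun s => hC _)
  exact (hF.comp continuous_real_toNNReal).aestronglyMeasurable

/-- No support condition on `h` is needed: on both sides `Real.toNNReal` moves the mass on the
negative half-line to the point `0`. -/
theorem integral_posPartMeasure_sub {h : ℝ → ℝ} (hh : Integrable h) {F : ℝ≥0 → E}
    (hF : Continuous F) {C : ℝ} (hC : ∀ s, ‖F s‖ ≤ C) :
    ∫ s, F s ∂(posPartMeasure h) - ∫ s, F s ∂(posPartMeasure (-h)) = densityIntegral h F := by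
  have key : ∀ g : ℝ → ℝ, Integrable g → ∫ s, F s ∂(posPartMeasure g) =
      ∫ s : ℝ, max (g s) 0 • F s.toNNReal := by
    intro g hg
    rw [posPartMeasure, integral_map measurable_real_toNNReal.aemeasurable hF.aestronglyMeasurable,
      integral_withDensity_eq_integral_toReal_smul₀ hg.1.aemeasurable.ennreal_ofReal
        (ae_of_all _ fun s => ENNReal.ofReal_lt_top)]
    rfl
  rw [key h hh, key _ hh.neg, densityIntegral, ← integral_sub]
  · congr 1
    funext s
    rw [← sub_smul]
    congr 1
    simp only [Pi.neg_apply]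
    rcases le_total (h s) 0 with h1 | h1 <;> simp [h1]
  · exact integrable_smul_comp_toNNReal (hh.pos_part) hF hC
  · exact integrable_smul_comp_toNNReal (hh.neg.pos_part) hF hC

end

section

variable {E : Type*} [NormedAddCommGroup E] [NormedSpace ℝ E]

omit [NormedSpace ℝ E] in
theorem integrable_of_continuous_of_bounded {m : Measure ℝ≥0} [IsFiniteMeasure m] {F : ℝ≥0 → E}
    (hF : Continuous F) {C : ℝ} (hC : ∀ s, ‖F s‖ ≤ C) : Integrable F m :=
  (integrable_const C).mono' hF.aestronglyMeasurable (ae_of_all _ hC)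

theorem integral_conv_of_bounded {m p : Measure ℝ≥0} [IsFiniteMeasure m] [IsFiniteMeasure p]
    {F : ℝ≥0 → E} (hF : Continuous F) {C : ℝ} (hC : ∀ s, ‖F s‖ ≤ C) :
    ∫ s, F s ∂(m.conv p) = ∫ a, ∫ b, F (a + b) ∂p ∂m :=
  integral_conv (integrable_of_continuous_of_bounded hF hC)

theorem integrable_integral_add {m p : Measure ℝ≥0} [IsFiniteMeasure m] [IsFiniteMeasure p]
    {F : ℝ≥0 → E} (hF : Continuous F) {C : ℝ} (hC : ∀ s, ‖F s‖ ≤ C) :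
    Integrable (fun a => ∫ b, F (a + b) ∂p) m := by
  refine integrable_of_continuous_of_bounded (C := C * p.real Set.univ) ?_ fun a => ?_
  · exact continuous_of_dominated (bound := fun _ => C)
      (fun a => (by fun_prop : Continuous fun b => F (a + b)).aestronglyMeasurable)
      (fun a => ae_of_all _ fun b => hC _) (integrable_const _)
      (ae_of_all _ fun b => by fun_prop)
  · exact norm_integral_le_of_norm_le_const (ae_of_all _ fun b => hC _)

theorem integral_conv_posPartMeasure_sub {m : Measure ℝ≥0} [IsFiniteMeasure m] {h : ℝ → ℝ}
    (hh : Integrable h) {F : ℝ≥0 → E} (hF : Continuous F) {C : ℝ} (hC : ∀ s, ‖F s‖ ≤ C) :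
    ∫ s, F s ∂(m.conv (posPartMeasure h)) - ∫ s, F s ∂(m.conv (posPartMeasure (-h))) =
      ∫ a, densityIntegral h (fun b => F (a + b)) ∂m := by
  have := isFiniteMeasure_posPartMeasure hh
  have := isFiniteMeasure_posPartMeasure hh.neg
  rw [integral_conv_of_bounded hF hC, integral_conv_of_bounded hF hC,
    ← integral_sub (integrable_integral_add hF hC) (integrable_integral_add hF hC)]
  congr 1
  funext a
  exact integral_posPartMeasure_sub hh (by fun_prop) fun s => hC _

/-- If `(ν₁ - ν₂) * h₁` and `(μ₁ - μ₂) * h₂` have the same Laplace transform, then they have the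
same integrals. -/
theorem integral_densityIntegral_eq {ν₁ ν₂ μ₁ μ₂ : Measure ℝ≥0} [IsFiniteMeasure ν₁]
    [IsFiniteMeasure ν₂] [IsFiniteMeasure μ₁] [IsFiniteMeasure μ₂] {h₁ h₂ : ℝ → ℝ}
    (hh₁ : Integrable h₁) (hh₂ : Integrable h₂)
    (hL : ∀ z : ℝ, 0 < z →
      (∫ s : ℝ≥0, Real.exp (-(z * s)) ∂ν₁ - ∫ s : ℝ≥0, Real.exp (-(z * s)) ∂ν₂) *
        densityIntegral h₁ (fun s : ℝ≥0 => Real.exp (-(z * s))) =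
      (∫ s : ℝ≥0, Real.exp (-(z * s)) ∂μ₁ - ∫ s : ℝ≥0, Real.exp (-(z * s)) ∂μ₂) *
        densityIntegral h₂ (fun s : ℝ≥0 => Real.exp (-(z * s))))
    {F : ℝ≥0 → E} (hF : Continuous F) {C : ℝ} (hC : ∀ s, ‖F s‖ ≤ C) :
    ∫ a, densityIntegral h₁ (fun b => F (a + b)) ∂ν₁ -
        ∫ a, densityIntegral h₁ (fun b => F (a + b)) ∂ν₂ =
      ∫ a, densityIntegral h₂ (fun b => F (a + b)) ∂μ₁ -
        ∫ a, densityIntegral h₂ (fun b => F (a + b)) ∂μ₂ := by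
  have := isFiniteMeasure_posPartMeasure hh₁
  have := isFiniteMeasure_posPartMeasure hh₁.neg
  have := isFiniteMeasure_posPartMeasure hh₂
  have := isFiniteMeasure_posPartMeasure hh₂.neg
  set p₁ := posPartMeasure h₁ with hp₁
  set n₁ := posPartMeasure (-h₁) with hn₁
  set p₂ := posPartMeasure h₂ with hp₂
  set n₂ := posPartMeasure (-h₂) with hn₂
  -- This is `(ν₁ - ν₂) * (p₁ - n₁) = (μ₁ - μ₂) * (p₂ - n₂)` with the negative terms moved across,
  -- so that uniqueness for positive measures applies.
  have key : ν₁.conv p₁ + ν₂.conv n₁ + μ₁.conv n₂ + μ₂.conv p₂ =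
      ν₂.conv p₁ + ν₁.conv n₁ + μ₁.conv p₂ + μ₂.conv n₂ := by
    refine ext_of_integral_exp_neg_mul_eq fun z hz => ?_
    have hc : Continuous fun s : ℝ≥0 => Real.exp (-(z * s)) := by fun_prop
    have hb : ∀ s : ℝ≥0, ‖Real.exp (-(z * s))‖ ≤ 1 := fun s => by
      rw [Real.norm_eq_abs, Real.abs_exp, Real.exp_le_one_iff, neg_nonpos]
      positivity
    have hi : ∀ m : Measure ℝ≥0, IsFiniteMeasure m →
        Integrable (fun s : ℝ≥0 => Real.exp (-(z * s))) m := fun m _ =>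
      integrable_of_continuous_of_bounded hc hb
    have hm : ∀ m : Measure ℝ≥0, IsFiniteMeasure m → ∀ h : ℝ → ℝ, Integrable h →
        ∫ s : ℝ≥0, Real.exp (-(z * s)) ∂(m.conv (posPartMeasure h)) -
          ∫ s : ℝ≥0, Real.exp (-(z * s)) ∂(m.conv (posPartMeasure (-h))) =
        (∫ s : ℝ≥0, Real.exp (-(z * s)) ∂m) *
          densityIntegral h (fun s : ℝ≥0 => Real.exp (-(z * s))) := by
      intro m _ h hh
      rw [integral_conv_posPartMeasure_sub hh hc hb, ← integral_mul_const]
      congr 1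
      funext a
      rw [densityIntegral, densityIntegral, ← integral_const_mul]
      congr 1
      funext s
      rw [NNReal.coe_add, mul_add, neg_add, Real.exp_add, smul_eq_mul, smul_eq_mul]
      ring
    have e1 := hm ν₁ inferInstance h₁ hh₁
    have e2 := hm ν₂ inferInstance h₁ hh₁
    have e3 := hm μ₁ inferInstance h₂ hh₂
    have e4 := hm μ₂ inferInstance h₂ hh₂
    have e5 := hL z hz
    rw [integral_add_measure (hi _ inferInstance) (hi _ inferInstance),
      integral_add_measure (hi _ inferInstance) (hi _ inferInstance),
      integral_add_measure (hi _ inferInstance) (hi _ inferInstance),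
      integral_add_measure (hi _ inferInstance) (hi _ inferInstance),
      integral_add_measure (hi _ inferInstance) (hi _ inferInstance),
      integral_add_measure (hi _ inferInstance) (hi _ inferInstance)]
    linear_combination e1 - e2 - e3 + e4 + e5
  have hi : ∀ m : Measure ℝ≥0, IsFiniteMeasure m → Integrable F m := fun m _ =>
    integrable_of_continuous_of_bounded hF hC
  have e := congrArg (fun m : Measure ℝ≥0 => ∫ s, F s ∂m) key
  rw [integral_add_measure (hi _ inferInstance) (hi _ inferInstance),
    integral_add_measure (hi _ inferInstance) (hi _ inferInstance),
    integral_add_measure (hi _ inferInstance) (hi _ inferInstance),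
    integral_add_measure (hi _ inferInstance) (hi _ inferInstance),
    integral_add_measure (hi _ inferInstance) (hi _ inferInstance),
    integral_add_measure (hi _ inferInstance) (hi _ inferInstance)] at e
  rw [← integral_conv_posPartMeasure_sub hh₁ hF hC, ← integral_conv_posPartMeasure_sub hh₁ hF hC,
    ← integral_conv_posPartMeasure_sub hh₂ hF hC, ← integral_conv_posPartMeasure_sub hh₂ hF hC]
  rw [← sub_eq_zero] at e ⊢
  rw [← e]
  abel

end

/-! ### The kernel `k_t`: integral, `L¹` norm and Laplace transform. -/

/-- The kernel `s ↦ s^(-α)` on `(0, ∞)`, extended by zero. -/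
def powKernel (α s : ℝ) : ℝ := (Set.Ioi (0 : ℝ)).indicator (fun s => s ^ (-α)) s

/-- The difference `p(s) - p(s - t)` for the kernel `p(s) = s^(-α)`. -/
def diffKernel (α t s : ℝ) : ℝ := powKernel α s - powKernel α (s - t)

theorem powKernel_of_pos {α s : ℝ} (hs : 0 < s) : powKernel α s = s ^ (-α) :=
  Set.indicator_of_mem (Set.mem_Ioi.2 hs) _

theorem powKernel_of_nonpos {α s : ℝ} (hs : s ≤ 0) : powKernel α s = 0 :=
  Set.indicator_of_notMem (by simpa using hs) _

theorem diffKernel_of_nonpos {α t s : ℝ} (ht : 0 ≤ t) (hs : s ≤ 0) : diffKernel α t s = 0 := by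
  rw [diffKernel, powKernel_of_nonpos hs, powKernel_of_nonpos (by linarith), sub_zero]

theorem diffKernel_of_le {α t s : ℝ} (hs : 0 < s) (hst : s ≤ t) : diffKernel α t s = s ^ (-α) := by
  rw [diffKernel, powKernel_of_pos hs, powKernel_of_nonpos (by linarith), sub_zero]

theorem diffKernel_of_lt {α t s : ℝ} (ht : 0 ≤ t) (hst : t < s) :
    diffKernel α t s = s ^ (-α) - (s - t) ^ (-α) := by
  rw [diffKernel, powKernel_of_pos (by linarith), powKernel_of_pos (by linarith)]

/-- The mixed second difference of `p` is symmetric in `t` and `δ`. In (b) this trades a kernel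
whose norm grows with `t` for one whose norm depends on `δ` only. -/
theorem diffKernel_sub_shift (α t δ s : ℝ) :
    diffKernel α t s - diffKernel α t (s - δ) = diffKernel α δ s - diffKernel α δ (s - t) := by
  simp only [diffKernel]
  rw [sub_right_comm s δ t]
  ring

theorem measurable_powKernel (α : ℝ) : Measurable (powKernel α) :=
  (measurable_id.pow_const (-α)).indicator measurableSet_Ioi

theorem measurable_diffKernel (α : ℝ) : Measurable fun q : ℝ × ℝ => diffKernel α q.1 q.2 := by
  have := measurable_powKernel α
  unfold diffKernel
  fun_prop

section

variable {α : ℝ} (hα : α ∈ Set.Ioo (0 : ℝ) 1)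
include hα

/-- The function is an antiderivative of `k_t` on `(t, ∞)`. Since `x ≤ x^(1-α)` on `[0, 1]`, applied
to `x = 1 - t/s`, its numerator lies between `0` and `t s^(-α)`. -/
theorem tendsto_rpow_sub_rpow_sub (t : ℝ) (ht : 0 ≤ t) :
    Tendsto (fun s : ℝ => (s ^ (1 - α) - (s - t) ^ (1 - α)) / (1 - α)) atTop (𝓝 0) := by
  have hβ : 0 < 1 - α := by linarith [hα.2]
  have h : Tendsto (fun s : ℝ => s ^ (1 - α) - (s - t) ^ (1 - α)) atTop (𝓝 0) := by
    have hlim : Tendsto (fun s : ℝ => t * s ^ (-α)) atTop (𝓝 0) := by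
      simpa using (tendsto_rpow_neg_atTop hα.1).const_mul t
    refine tendsto_of_tendsto_of_tendsto_of_le_of_le' tendsto_const_nhds hlim ?_ ?_
    · filter_upwards [eventually_gt_atTop t] with s hs
      exact sub_nonneg.2 (Real.rpow_le_rpow (by linarith) (by linarith) hβ.le)
    · filter_upwards [eventually_gt_atTop t, eventually_gt_atTop 0] with s hs hs0
      have h1 : 1 - t / s ≤ (1 - t / s) ^ (1 - α) := by
        have h0 : 0 ≤ 1 - t / s := by
          rw [sub_nonneg, div_le_one hs0]; exact hs.le
        exact Real.self_le_rpow_of_le_one h0 (by linarith [div_nonneg ht hs0.le]) (by linarith [hα.1])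
      have h2 : (s - t) ^ (1 - α) = s ^ (1 - α) * (1 - t / s) ^ (1 - α) := by
        rw [← Real.mul_rpow hs0.le (by rw [sub_nonneg, div_le_one hs0]; exact hs.le)]
        congr 1
        field_simp
      have h3 : s ^ (1 - α) = s * s ^ (-α) := by
        rw [sub_eq_add_neg, Real.rpow_add hs0, Real.rpow_one]
      have h4 : 0 < s ^ (1 - α) := Real.rpow_pos_of_pos hs0 _
      calc s ^ (1 - α) - (s - t) ^ (1 - α) ≤ s ^ (1 - α) - s ^ (1 - α) * (1 - t / s) := by
            rw [h2]; gcongr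
        _ = t * s ^ (-α) := by rw [h3]; field_simp; ring
  simpa using h.div_const (1 - α)

theorem hasDerivAt_rpow_sub_rpow_sub {t s : ℝ} (ht : 0 ≤ t) (hs : t < s) :
    HasDerivAt (fun s : ℝ => (s ^ (1 - α) - (s - t) ^ (1 - α)) / (1 - α)) (diffKernel α t s) s := by
  have hβ : 1 - α ≠ 0 := by linarith [hα.2]
  have h1 := Real.hasDerivAt_rpow_const (x := s) (p := 1 - α) (Or.inl (by linarith))
  have h2 := (Real.hasDerivAt_rpow_const (x := s - t) (p := 1 - α) (Or.inl (by linarith))).comp s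
    ((hasDerivAt_id s).sub_const t)
  rw [diffKernel_of_lt ht hs]
  refine ((h1.sub h2).div_const (1 - α)).congr_deriv ?_
  rw [show 1 - α - 1 = -α by ring]
  field_simp

theorem continuousWithinAt_rpow_sub_rpow_sub {t : ℝ} :
    ContinuousWithinAt (fun s : ℝ => (s ^ (1 - α) - (s - t) ^ (1 - α)) / (1 - α)) (Set.Ici t) t := by
  have hβ : 0 ≤ 1 - α := by linarith [hα.2]
  refine Continuous.continuousWithinAt ?_
  exact ((Real.continuous_rpow_const hβ).sub
    ((Real.continuous_rpow_const hβ).comp (by fun_prop))).div_const _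

theorem diffKernel_nonpos {t s : ℝ} (ht : 0 ≤ t) (hs : t < s) : diffKernel α t s ≤ 0 := by
  rw [diffKernel_of_lt ht hs, sub_nonpos]
  exact Real.rpow_le_rpow_of_nonpos (by linarith) (by linarith) (by linarith [hα.1])

theorem integrableOn_Ioi_diffKernel {t : ℝ} (ht : 0 ≤ t) :
    IntegrableOn (diffKernel α t) (Set.Ioi t) :=
  integrableOn_Ioi_deriv_of_nonpos (continuousWithinAt_rpow_sub_rpow_sub hα)
    (fun _ hs => hasDerivAt_rpow_sub_rpow_sub hα ht hs) (fun _ hs => diffKernel_nonpos hα ht hs)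
    (tendsto_rpow_sub_rpow_sub hα t ht)

theorem integral_Ioi_diffKernel {t : ℝ} (ht : 0 ≤ t) :
    ∫ s in Set.Ioi t, diffKernel α t s = -(t ^ (1 - α) / (1 - α)) := by
  rw [integral_Ioi_of_hasDerivAt_of_nonpos (continuousWithinAt_rpow_sub_rpow_sub hα)
    (fun _ hs => hasDerivAt_rpow_sub_rpow_sub hα ht hs) (fun _ hs => diffKernel_nonpos hα ht hs)
    (tendsto_rpow_sub_rpow_sub hα t ht)]
  rw [sub_self, Real.zero_rpow (by linarith [hα.2])]
  ring

theorem intervalIntegrable_rpow_neg (t : ℝ) :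
    IntervalIntegrable (fun s : ℝ => s ^ (-α)) volume 0 t :=
  intervalIntegral.intervalIntegrable_rpow' (by linarith [hα.2])

theorem integrableOn_Ioc_diffKernel {t : ℝ} (ht : 0 ≤ t) :
    IntegrableOn (diffKernel α t) (Set.Ioc 0 t) := by
  refine (((intervalIntegrable_iff_integrableOn_Ioc_of_le ht).1
    (intervalIntegrable_rpow_neg hα t))).congr_fun (fun s hs => ?_) measurableSet_Ioc
  exact (diffKernel_of_le hs.1 hs.2).symm

theorem integral_Ioc_diffKernel {t : ℝ} (ht : 0 ≤ t) :
    ∫ s in Set.Ioc 0 t, diffKernel α t s = t ^ (1 - α) / (1 - α) := by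
  rw [setIntegral_congr_fun measurableSet_Ioc fun s hs => diffKernel_of_le hs.1 hs.2,
    ← intervalIntegral.integral_of_le ht, integral_rpow (Or.inl (by linarith [hα.2])),
    Real.zero_rpow (by linarith [hα.2]), sub_zero]
  ring_nf

theorem integrable_diffKernel {t : ℝ} (ht : 0 ≤ t) : Integrable (diffKernel α t) := by
  rw [← integrableOn_univ, ← Set.Iic_union_Ioi (a := (0 : ℝ)), ← Set.Ioc_union_Ioi_eq_Ioi ht]
  refine IntegrableOn.union ?_ ((integrableOn_Ioc_diffKernel hα ht).union
    (integrableOn_Ioi_diffKernel hα ht))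
  exact integrableOn_zero.congr_fun (fun s hs => (diffKernel_of_nonpos ht hs).symm) measurableSet_Iic

omit hα in
theorem integral_eq_Ioc_add_Ioi {f : ℝ → ℝ} (hf : Integrable f) {t : ℝ} (ht : 0 ≤ t)
    (h0 : ∀ s ≤ 0, f s = 0) :
    ∫ s, f s = (∫ s in Set.Ioc 0 t, f s) + ∫ s in Set.Ioi t, f s := by
  rw [← setIntegral_union (Set.Ioc_disjoint_Ioi le_rfl) measurableSet_Ioi hf.integrableOn
    hf.integrableOn, Set.Ioc_union_Ioi_eq_Ioi ht]
  refine (setIntegral_eq_integral_of_forall_compl_eq_zero fun s hs => h0 s ?_).symm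
  simpa using hs

theorem integral_diffKernel {t : ℝ} (ht : 0 ≤ t) : ∫ s, diffKernel α t s = 0 := by
  rw [integral_eq_Ioc_add_Ioi (integrable_diffKernel hα ht) ht
    fun s hs => diffKernel_of_nonpos ht hs, integral_Ioc_diffKernel hα ht,
    integral_Ioi_diffKernel hα ht, add_neg_cancel]

/-- `k_t` is nonnegative on `(0, t]` and nonpositive beyond, with opposite integrals over the two
pieces. The rate in (a) is this value divided by `t`. -/
theorem integral_abs_diffKernel {t : ℝ} (ht : 0 ≤ t) :
    ∫ s, |diffKernel α t s| = 2 * t ^ (1 - α) / (1 - α) := by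
  rw [integral_eq_Ioc_add_Ioi (integrable_diffKernel hα ht).abs ht
    fun s hs => by rw [diffKernel_of_nonpos ht hs, abs_zero],
    setIntegral_congr_fun measurableSet_Ioc fun s hs =>
      show |diffKernel α t s| = diffKernel α t s from abs_of_nonneg (by
        rw [diffKernel_of_le hs.1 hs.2]; exact Real.rpow_nonneg hs.1.le _),
    setIntegral_congr_fun measurableSet_Ioi fun s hs =>
      show |diffKernel α t s| = -diffKernel α t s from
        abs_of_nonpos (diffKernel_nonpos hα ht hs), integral_neg, integral_Ioc_diffKernel hα ht,
    integral_Ioi_diffKernel hα ht]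
  ring

theorem integrable_powKernel_mul_exp {z : ℝ} (hz : 0 < z) :
    Integrable fun s : ℝ => powKernel α s * Real.exp (-(z * s)) := by
  have h : IntegrableOn (fun s : ℝ => s ^ (-α) * Real.exp (-z * s ^ (1 : ℝ))) (Set.Ioi 0) :=
    integrableOn_rpow_mul_exp_neg_mul_rpow (by linarith [hα.2]) one_pos hz
  rw [← integrable_indicator_iff measurableSet_Ioi] at h
  refine h.congr (ae_of_all _ fun s => ?_)
  by_cases hs : 0 < s
  · simp [powKernel, hs]
  · simp [powKernel, hs]

omit hα in
theorem powKernel_nonneg (s : ℝ) : 0 ≤ powKernel α s :=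
  Set.indicator_nonneg (fun _ hs => Real.rpow_nonneg (le_of_lt hs) _) s

theorem integrable_powKernel_mul_cexp {z : ℂ} (hz : 0 < z.re) :
    Integrable fun s : ℝ => (powKernel α s : ℂ) * Complex.exp (-(s : ℂ) * z) := by
  refine (integrable_powKernel_mul_exp hα hz).mono' ?_ (ae_of_all _ fun s => ?_)
  · have := measurable_powKernel α
    exact Measurable.aestronglyMeasurable (by fun_prop)
  · rw [norm_mul, Complex.norm_exp, Complex.norm_real, Real.norm_of_nonneg (powKernel_nonneg s)]
    refine le_of_eq ?_
    congr 2
    simp [mul_comm]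

theorem integral_powKernel_mul_exp {z : ℝ} (hz : 0 < z) :
    ∫ s : ℝ, powKernel α s * Real.exp (-(z * s)) = z ^ (α - 1) * Real.Gamma (1 - α) := by
  have h := Real.integral_rpow_mul_exp_neg_mul_Ioi (a := 1 - α) (r := z) (by linarith [hα.2]) hz
  rw [one_div, Real.inv_rpow hz.le, ← Real.rpow_neg hz.le, neg_sub] at h
  rw [← h, ← integral_indicator measurableSet_Ioi]
  congr 1
  funext s
  by_cases hs : 0 < s
  · simp [powKernel, hs]
  · simp [powKernel, hs]

/-- Identity theorem: both sides are analytic on the right half-plane and agree on the positive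
reals by the Gamma integral. Analyticity of the left side comes from reading it as a complex moment
generating function. -/
theorem integral_powKernel_mul_cexp {z : ℂ} (hz : 0 < z.re) :
    ∫ s : ℝ, (powKernel α s : ℂ) * Complex.exp (-(s : ℂ) * z) =
      z ^ ((α : ℂ) - 1) * Real.Gamma (1 - α) := by
  set ρ : Measure ℝ := volume.withDensity fun s => ENNReal.ofReal (powKernel α s) with hρ
  have hm : AEMeasurable (fun s => ENNReal.ofReal (powKernel α s)) :=
    (measurable_powKernel α).ennreal_ofReal.aemeasurable
  have hint : Set.Ioi (0 : ℝ) ⊆ interior (ProbabilityTheory.integrableExpSet (fun s : ℝ => -s) ρ) := by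
    refine isOpen_Ioi.subset_interior_iff.2 fun w hw => ?_
    rw [ProbabilityTheory.integrableExpSet, Set.mem_ofPred_eq, hρ,
      integrable_withDensity_iff_integrable_smul₀' hm (ae_of_all _ fun s => ENNReal.ofReal_lt_top)]
    refine (integrable_powKernel_mul_exp hα hw).congr (ae_of_all _ fun s => ?_)
    simp only [ENNReal.toReal_ofReal (powKernel_nonneg s), smul_eq_mul, mul_neg]
  have heq : ∀ w : ℂ, ProbabilityTheory.complexMGF (fun s : ℝ => -s) ρ w =
      ∫ s : ℝ, (powKernel α s : ℂ) * Complex.exp (-(s : ℂ) * w) := by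
    intro w
    rw [ProbabilityTheory.complexMGF, hρ, integral_withDensity_eq_integral_toReal_smul₀ hm
      (ae_of_all _ fun s => ENNReal.ofReal_lt_top)]
    congr 1
    funext s
    rw [ENNReal.toReal_ofReal (powKernel_nonneg s), Complex.real_smul, mul_comm w]
    push_cast
    rfl
  rw [← heq]
  have hU : IsPreconnected {w : ℂ | 0 < w.re} := (convex_halfSpace_re_gt 0).isPreconnected
  refine AnalyticOnNhd.eqOn_of_preconnected_of_frequently_eq (z₀ := 1)
    (f := ProbabilityTheory.complexMGF (fun s : ℝ => -s) ρ)
    (g := fun w => w ^ ((α : ℂ) - 1) * Real.Gamma (1 - α)) ?_ ?_ hU ?_ ?_ hz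
  · exact fun w hw => ProbabilityTheory.analyticAt_complexMGF (hint hw)
  · exact fun w hw => ((analyticAt_id.cpow analyticAt_const (Or.inl hw)).mul analyticAt_const)
  · simp
  · have h1 : ∃ᶠ x : ℝ in 𝓝[≠] 1, 0 < x :=
      (eventually_nhdsWithin_of_eventually_nhds (lt_mem_nhds one_pos)).frequently
    have h2 : Tendsto (fun x : ℝ => (x : ℂ)) (𝓝[≠] 1) (𝓝[≠] 1) := by
      refine tendsto_nhdsWithin_of_tendsto_nhds_of_eventually_within _ ?_ ?_
      · have : Tendsto (fun x : ℝ => (x : ℂ)) (𝓝 1) (𝓝 ((1 : ℝ) : ℂ)) :=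
          Complex.continuous_ofReal.continuousAt
        rw [Complex.ofReal_one] at this
        exact this.mono_left nhdsWithin_le_nhds
      · filter_upwards [self_mem_nhdsWithin] with x hx
        simpa using hx
    refine h2.frequently (h1.mono fun x hx => ?_)
    rw [heq]
    have h3 := congrArg (fun r : ℝ => (r : ℂ)) (integral_powKernel_mul_exp hα hx)
    rw [← integral_complex_ofReal, Complex.ofReal_mul, Complex.ofReal_cpow hx.le] at h3
    push_cast at h3
    rw [← h3]
    congr 1
    funext s
    rw [neg_mul, mul_comm (x : ℂ)]

theorem integral_diffKernel_mul_cexp {t : ℝ} {z : ℂ} (hz : 0 < z.re) :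
    ∫ s : ℝ, (diffKernel α t s : ℂ) * Complex.exp (-(s : ℂ) * z) =
      z ^ ((α : ℂ) - 1) * Real.Gamma (1 - α) * (1 - Complex.exp (-(t : ℂ) * z)) := by
  have h0 := integrable_powKernel_mul_cexp hα hz
  have h1 : ∀ s : ℝ, (diffKernel α t s : ℂ) * Complex.exp (-(s : ℂ) * z) =
      (powKernel α s : ℂ) * Complex.exp (-(s : ℂ) * z) - Complex.exp (-(t : ℂ) * z) *
        ((powKernel α (s - t) : ℂ) * Complex.exp (-((s - t : ℝ) : ℂ) * z)) := by
    intro s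
    have : Complex.exp (-(s : ℂ) * z) =
        Complex.exp (-(t : ℂ) * z) * Complex.exp (-((s - t : ℝ) : ℂ) * z) := by
      rw [← Complex.exp_add]
      congr 1
      push_cast
      ring
    rw [diffKernel, Complex.ofReal_sub, sub_mul]
    congr 1
    rw [this]
    ring
  simp_rw [h1]
  rw [integral_sub h0 ((h0.comp_sub_right t).const_mul _), integral_const_mul,
    integral_sub_right_eq_self (fun s : ℝ => (powKernel α s : ℂ) * Complex.exp (-(s : ℂ) * z)) t,
    integral_powKernel_mul_cexp hα hz]
  ring

end

/-! ### Operators `∫ h(s) T(s) ds` and the Hille-Phillips calculus on positive parts. -/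

namespace C0Semigroup

variable {X : Type*} [NormedAddCommGroup X] [NormedSpace ℂ X] (T : C0Semigroup X)

theorem continuous_orbit (x : X) : Continuous fun s : ℝ => T.op s.toNNReal x :=
  (T.strongly_continuous x).comp continuous_real_toNNReal

theorem op_comm (s t : ℝ≥0) : T.op s * T.op t = T.op t * T.op s := by
  rw [← T.op_add, ← T.op_add, add_comm]

variable {T} in
theorem norm_op_apply_le {M : ℝ} (hM : ∀ s, ‖T.op s‖ ≤ M) (x : X) (s : ℝ≥0) :
    ‖T.op s x‖ ≤ M * ‖x‖ :=
  (T.op s).le_of_opNorm_le (hM s) x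

variable {T} in
theorem nonneg_of_norm_op_le {M : ℝ} (hM : ∀ s, ‖T.op s‖ ≤ M) : 0 ≤ M :=
  (norm_nonneg _).trans (hM 0)

variable {T} in
theorem norm_densityIntegral_le {M : ℝ} (hM : ∀ s, ‖T.op s‖ ≤ M) {h : ℝ → ℝ} (hh : Integrable h)
    (x : X) : ‖densityIntegral h fun s => T.op s x‖ ≤ (M * ∫ s, |h s|) * ‖x‖ := by
  rw [mul_right_comm, mul_comm, ← integral_mul_const]
  refine norm_integral_le_of_norm_le (hh.abs.mul_const _) (ae_of_all _ fun s => ?_)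
  rw [norm_smul, Real.norm_eq_abs]
  exact mul_le_mul_of_nonneg_left (norm_op_apply_le hM x _) (abs_nonneg _)

variable {T} in
theorem integrable_density_smul_op (hT : T.IsBounded) {h : ℝ → ℝ} (hh : Integrable h) (x : X) :
    Integrable fun s : ℝ => h s • T.op s.toNNReal x := by
  obtain ⟨M, hM⟩ := hT
  exact integrable_smul_comp_toNNReal hh (T.strongly_continuous x) (norm_op_apply_le hM x)

/-- The operator `x ↦ ∫ h(s) T(s)x ds` for an integrable density `h`. -/
def densityOp (hT : T.IsBounded) {h : ℝ → ℝ} (hh : Integrable h) : X →L[ℂ] X :=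
  LinearMap.mkContinuous
    { toFun := fun x => densityIntegral h fun s => T.op s x
      map_add' := fun x y => by
        simp only [densityIntegral, map_add, smul_add]
        exact integral_add (integrable_density_smul_op hT hh x) (integrable_density_smul_op hT hh y)
      map_smul' := fun c x => by
        simp only [densityIntegral, map_smul, RingHom.id_apply]
        rw [← integral_smul]
        simp only [smul_comm c] }
    (hT.choose * ∫ s, |h s|) (norm_densityIntegral_le hT.choose_spec hh)

variable {T} {hT : T.IsBounded}

theorem densityOp_apply {h : ℝ → ℝ} (hh : Integrable h) (x : X) :
    T.densityOp hT hh x = ∫ s : ℝ, h s • T.op s.toNNReal x := rfl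

section

variable [CompleteSpace X]

theorem apply_densityOp {S : X →L[ℂ] X} (hS : ∀ s, Commute S (T.op s)) {h : ℝ → ℝ}
    (hh : Integrable h) (x : X) : S (T.densityOp hT hh x) = T.densityOp hT hh (S x) := by
  rw [densityOp_apply, densityOp_apply,
    ← ContinuousLinearMap.integral_comp_comm S (integrable_density_smul_op hT hh x)]
  congr 1
  funext s
  rw [ContinuousLinearMap.map_smul_of_tower]
  congr 1
  exact congrArg (fun L : X →L[ℂ] X => L x) (hS s.toNNReal)

theorem commute_densityOp {S : X →L[ℂ] X} (hS : ∀ s, Commute S (T.op s)) {h : ℝ → ℝ}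
    (hh : Integrable h) : Commute S (T.densityOp hT hh) := by
  ext x
  exact apply_densityOp hS hh x

theorem commute_densityOp_op {h : ℝ → ℝ} (hh : Integrable h) (s : ℝ≥0) :
    Commute (T.densityOp hT hh) (T.op s) :=
  (commute_densityOp (fun t => T.op_comm s t) hh).symm

theorem op_densityOp {h : ℝ → ℝ} (hh : Integrable h) (a : ℝ≥0) (x : X) :
    T.op a (T.densityOp hT hh x) = densityIntegral h fun b => T.op (a + b) x := by
  rw [apply_densityOp (fun t => T.op_comm a t) hh, densityOp_apply, densityIntegral]
  congr 1
  funext s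
  rw [add_comm, T.op_add]
  rfl

include hT

omit [CompleteSpace X] in
theorem integrable_op_apply {m : Measure ℝ≥0} [IsFiniteMeasure m] (x : X) :
    Integrable (fun s => T.op s x) m := by
  obtain ⟨M, hM⟩ := hT
  exact integrable_of_continuous_of_bounded (T.strongly_continuous x) (norm_op_apply_le hM x)

theorem hillePhillips_eq (m₁ m₂ m₃ m₄ : Measure ℝ≥0) [IsFiniteMeasure m₁] [IsFiniteMeasure m₂]
    [IsFiniteMeasure m₃] [IsFiniteMeasure m₄] (x : X) :
    T.hillePhillips ((complexMeasureOf m₁ 1 + complexMeasureOf m₂ (-1)) +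
        (complexMeasureOf m₃ Complex.I + complexMeasureOf m₄ (-Complex.I))) x =
      (∫ s, T.op s x ∂m₁ - ∫ s, T.op s x ∂m₂) +
        Complex.I • (∫ s, T.op s x ∂m₃ - ∫ s, T.op s x ∂m₄) := by
  have h : ∀ m : Measure ℝ≥0, IsFiniteMeasure m → Integrable (fun s => T.op s x) m :=
    fun m _ => integrable_op_apply (hT := hT) x
  have h' : ∀ (m : Measure ℝ≥0) (_ : IsFiniteMeasure m) (c : ℂ),
      (complexMeasureOf m c).Integrable (fun s => T.op s x) :=
    fun m _ c => integrable_variation_complexMeasureOf (h m inferInstance)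
  rw [hillePhillips, VectorMeasure.integral_add_vectorMeasure
      ((h' m₁ inferInstance _).add_vectorMeasure (h' m₂ inferInstance _))
      ((h' m₃ inferInstance _).add_vectorMeasure (h' m₄ inferInstance _)),
    VectorMeasure.integral_add_vectorMeasure (h' m₁ inferInstance _) (h' m₂ inferInstance _),
    VectorMeasure.integral_add_vectorMeasure (h' m₃ inferInstance _) (h' m₄ inferInstance _),
    integral_complexMeasureOf (h m₁ inferInstance), integral_complexMeasureOf (h m₂ inferInstance),
    integral_complexMeasureOf (h m₃ inferInstance), integral_complexMeasureOf (h m₄ inferInstance)]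
  simp only [neg_smul, one_smul, smul_sub]
  abel

theorem apply_hillePhillips {S : X →L[ℂ] X} (hS : ∀ s, Commute S (T.op s))
    (μ : ComplexMeasure ℝ≥0) (x : X) : S (T.hillePhillips μ x) = T.hillePhillips μ (S x) := by
  obtain ⟨m₁, m₂, m₃, m₄, _, _, _, _, rfl⟩ := exists_eq_complexMeasureOf μ
  have h : ∀ (m : Measure ℝ≥0) (_ : IsFiniteMeasure m),
      S (∫ s, T.op s x ∂m) = ∫ s, T.op s (S x) ∂m := fun m _ => by
    rw [← ContinuousLinearMap.integral_comp_comm S (integrable_op_apply (hT := hT) x)]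
    congr 1
    funext s
    exact congrArg (fun L : X →L[ℂ] X => L x) (hS s)
  rw [hillePhillips_eq (hT := hT), hillePhillips_eq (hT := hT)]
  simp only [map_add, map_smul, map_sub, h]

end

end C0Semigroup

/-! ### From identities of Laplace transforms to identities of operators. -/

theorem norm_cexp_neg_mul_le (s : ℝ≥0) {z : ℂ} (hz : 0 ≤ z.re) :
    ‖Complex.exp (-((s : ℝ) : ℂ) * z)‖ ≤ 1 := by
  rw [Complex.norm_exp, Real.exp_le_one_iff]
  simp only [neg_mul, Complex.neg_re, Complex.re_ofReal_mul, neg_nonpos]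
  positivity

theorem laplaceTransform_eq (m₁ m₂ m₃ m₄ : Measure ℝ≥0) [IsFiniteMeasure m₁] [IsFiniteMeasure m₂]
    [IsFiniteMeasure m₃] [IsFiniteMeasure m₄] {z : ℂ} (hz : 0 ≤ z.re) :
    laplaceTransform ((complexMeasureOf m₁ 1 + complexMeasureOf m₂ (-1)) +
        (complexMeasureOf m₃ Complex.I + complexMeasureOf m₄ (-Complex.I))) z =
      (∫ s : ℝ≥0, Complex.exp (-((s : ℝ) : ℂ) * z) ∂m₁ -
        ∫ s : ℝ≥0, Complex.exp (-((s : ℝ) : ℂ) * z) ∂m₂) +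
        Complex.I * (∫ s : ℝ≥0, Complex.exp (-((s : ℝ) : ℂ) * z) ∂m₃ -
          ∫ s : ℝ≥0, Complex.exp (-((s : ℝ) : ℂ) * z) ∂m₄) := by
  have h : ∀ m : Measure ℝ≥0, IsFiniteMeasure m →
      Integrable (fun s : ℝ≥0 => Complex.exp (-((s : ℝ) : ℂ) * z)) m :=
    fun m _ => integrable_of_continuous_of_bounded (by fun_prop) fun s => norm_cexp_neg_mul_le s hz
  have h' : ∀ (m : Measure ℝ≥0) (_ : IsFiniteMeasure m) (c : ℂ),
      (complexMeasureOf m c).Integrable (fun s : ℝ≥0 => Complex.exp (-((s : ℝ) : ℂ) * z)) :=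
    fun m _ c => integrable_variation_complexMeasureOf (h m inferInstance)
  have hB : ContinuousLinearMap.mul ℝ ℂ = (ContinuousLinearMap.lsmul ℝ ℂ (E := ℂ)).flip := by
    ext x y
    simp [mul_comm]
  rw [laplaceTransform, hB, VectorMeasure.integral_add_vectorMeasure
      ((h' m₁ inferInstance _).add_vectorMeasure (h' m₂ inferInstance _))
      ((h' m₃ inferInstance _).add_vectorMeasure (h' m₄ inferInstance _)),
    VectorMeasure.integral_add_vectorMeasure (h' m₁ inferInstance _) (h' m₂ inferInstance _),
    VectorMeasure.integral_add_vectorMeasure (h' m₃ inferInstance _) (h' m₄ inferInstance _),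
    integral_complexMeasureOf (h m₁ inferInstance), integral_complexMeasureOf (h m₂ inferInstance),
    integral_complexMeasureOf (h m₃ inferInstance), integral_complexMeasureOf (h m₄ inferInstance)]
  simp only [smul_eq_mul]
  ring

theorem integral_cexp_ofReal (m : Measure ℝ≥0) (z : ℝ) :
    ∫ s : ℝ≥0, Complex.exp (-((s : ℝ) : ℂ) * z) ∂m =
      ((∫ s : ℝ≥0, Real.exp (-(z * s)) ∂m : ℝ) : ℂ) := by
  rw [← integral_complex_ofReal]
  congr 1
  funext s
  push_cast
  rw [neg_mul, mul_comm]

namespace C0Semigroup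

variable {X : Type*} [NormedAddCommGroup X] [NormedSpace ℂ X] [CompleteSpace X] {T : C0Semigroup X}
  {hT : T.IsBounded}

/-- The Hille-Phillips calculus only depends on Laplace transforms: if `ν̂ ĥ₁ = μ̂ ĥ₂`, then
`ν̂(A) ĥ₁(A) = μ̂(A) ĥ₂(A)`. -/
theorem hillePhillips_densityOp_eq {μ ν : ComplexMeasure ℝ≥0} {h₁ h₂ : ℝ → ℝ}
    (hh₁ : Integrable h₁) (hh₂ : Integrable h₂)
    (hL : ∀ z : ℝ, 0 < z →
      laplaceTransform ν z * (densityIntegral h₁ (fun s : ℝ≥0 => Real.exp (-(z * s))) : ℝ) =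
        laplaceTransform μ z * (densityIntegral h₂ (fun s : ℝ≥0 => Real.exp (-(z * s))) : ℝ))
    (x : X) :
    T.hillePhillips ν (T.densityOp hT hh₁ x) = T.hillePhillips μ (T.densityOp hT hh₂ x) := by
  obtain ⟨m₁, m₂, m₃, m₄, _, _, _, _, rfl⟩ := exists_eq_complexMeasureOf μ
  obtain ⟨n₁, n₂, n₃, n₄, _, _, _, _, rfl⟩ := exists_eq_complexMeasureOf ν
  obtain ⟨M, hM⟩ := id hT
  have hF := T.strongly_continuous x
  have hb := norm_op_apply_le hM x
  -- At real `z` the integrals against the positive measures are real, so the hypothesis splits into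
  -- real and imaginary parts, one for each pair of positive measures.
  have hL' : ∀ z : ℝ, 0 < z → _ := fun z hz => by
    have h := hL z hz
    rw [laplaceTransform_eq _ _ _ _ (by simpa using hz.le),
      laplaceTransform_eq _ _ _ _ (by simpa using hz.le)] at h
    simp only [integral_cexp_ofReal] at h
    exact h
  rw [hillePhillips_eq (hT := hT), hillePhillips_eq (hT := hT)]
  simp only [op_densityOp]
  rw [integral_densityIntegral_eq (ν₁ := n₁) (ν₂ := n₂) (μ₁ := m₁) (μ₂ := m₂) hh₁ hh₂
      (fun z hz => by simpa using congrArg Complex.re (hL' z hz)) hF hb,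
    integral_densityIntegral_eq (ν₁ := n₃) (ν₂ := n₄) (μ₁ := m₃) (μ₂ := m₄) hh₁ hh₂
      (fun z hz => by simpa using congrArg Complex.im (hL' z hz)) hF hb]

/-- The density of the uniform distribution on `(0, t]`. -/
def _root_.cesaroKernel (t : ℝ) : ℝ → ℝ := (Set.Ioc 0 t).indicator fun _ => t⁻¹

theorem _root_.integrable_cesaroKernel (t : ℝ) : Integrable (cesaroKernel t) :=
  (integrable_indicator_iff measurableSet_Ioc).2 (integrableOn_const (by simp))

omit [CompleteSpace X] in
theorem cesaro_eq_densityOp {t : ℝ} (ht : 0 ≤ t) (x : X) :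
    T.cesaro t x = T.densityOp hT (integrable_cesaroKernel t) x := by
  rw [cesaro, densityOp_apply, intervalIntegral.integral_of_le ht, ← integral_smul,
    ← integral_indicator measurableSet_Ioc]
  congr 1
  funext s
  by_cases hs : s ∈ Set.Ioc 0 t <;> simp [cesaroKernel, hs]

theorem _root_.densityIntegral_cesaroKernel {t z : ℝ} (ht : 0 < t) (hz : 0 < z) :
    densityIntegral (cesaroKernel t) (fun s : ℝ≥0 => Real.exp (-(z * s))) =
      (1 - Real.exp (-(t * z))) / (t * z) := by
  have h1 : densityIntegral (cesaroKernel t) (fun s : ℝ≥0 => Real.exp (-(z * s))) =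
      t⁻¹ * ∫ s in (0 : ℝ)..t, Real.exp (-z * s) := by
    rw [densityIntegral, intervalIntegral.integral_of_le ht.le, ← integral_const_mul,
      ← integral_indicator measurableSet_Ioc]
    congr 1
    funext s
    by_cases hs : s ∈ Set.Ioc 0 t
    · simp [cesaroKernel, hs, hs.1.le]
    · simp [cesaroKernel, hs]
  have h2 : ∫ s in (0 : ℝ)..t, Real.exp (-z * s) = (1 - Real.exp (-(t * z))) / z := by
    rw [intervalIntegral.integral_comp_mul_left (fun s => Real.exp s) (by linarith : -z ≠ 0),
      integral_exp, mul_zero, Real.exp_zero, smul_eq_mul, neg_mul, mul_comm z t]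
    field_simp
    ring
  rw [h1, h2]
  field_simp

theorem _root_.densityIntegral_diffKernel {α : ℝ} (hα : α ∈ Set.Ioo (0 : ℝ) 1) {t z : ℝ}
    (ht : 0 < t) (hz : 0 < z) :
    densityIntegral (diffKernel α t) (fun s : ℝ≥0 => Real.exp (-(z * s))) =
      z ^ (α - 1) * Real.Gamma (1 - α) * (1 - Real.exp (-(t * z))) := by
  have h := integral_diffKernel_mul_cexp hα (t := t) (z := z) (by simpa using hz)
  rw [← Complex.ofReal_inj]
  push_cast
  rw [Complex.ofReal_cpow hz.le, ← neg_mul]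
  push_cast
  rw [← h, densityIntegral, ← integral_complex_ofReal]
  congr 1
  funext s
  rcases le_or_gt s 0 with hs | hs
  · simp [diffKernel_of_nonpos ht.le hs]
  · rw [Real.coe_toNNReal _ hs.le, smul_eq_mul]
    push_cast
    rw [neg_mul, mul_comm (z : ℂ)]

end C0Semigroup

/-! ### Orbit derivatives, and parts (a) and (b). -/

namespace C0Semigroup

variable {X : Type*} [NormedAddCommGroup X] [NormedSpace ℂ X] {T : C0Semigroup X}

theorem op_toNNReal_add {s r : ℝ} (hs : 0 ≤ s) (hr : 0 ≤ r) (x : X) :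
    T.op (s + r).toNNReal x = T.op s.toNNReal (T.op r.toNNReal x) := by
  rw [Real.toNNReal_add hs hr, T.op_add]
  rfl

theorem HasOrbitDeriv.hasDerivWithinAt {x y : X} (h : T.HasOrbitDeriv x y) {s : ℝ} (hs : 0 ≤ s) :
    HasDerivWithinAt (fun r : ℝ => T.op r.toNNReal x) (T.op s.toNNReal y) (Set.Ioi s) s := by
  rw [hasDerivWithinAt_iff_tendsto_slope' (by simp)]
  have h1 : Tendsto (fun r : ℝ => r - s) (𝓝[>] s) (𝓝[>] 0) := by
    refine tendsto_nhdsWithin_of_tendsto_nhds_of_eventually_within _ ?_ ?_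
    · have : Tendsto (fun r : ℝ => r - s) (𝓝 s) (𝓝 (s - s)) := by
        exact (continuous_id.sub continuous_const).continuousAt
      rw [sub_self] at this
      exact this.mono_left nhdsWithin_le_nhds
    · filter_upwards [self_mem_nhdsWithin] with r hr
      exact sub_pos.2 (Set.mem_Ioi.1 hr)
  refine (((T.op s.toNNReal).continuous.tendsto y).comp (Tendsto.comp h h1)).congr' ?_
  filter_upwards [self_mem_nhdsWithin] with r hr
  have hr' : 0 ≤ r - s := sub_nonneg.2 (le_of_lt hr)
  have h2 := op_toNNReal_add (T := T) hs hr' x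
  rw [add_sub_cancel] at h2
  simp only [Function.comp_apply, slope, vsub_eq_sub]
  rw [h2, ContinuousLinearMap.map_smul_of_tower, map_sub]

theorem HasOrbitDeriv.integral_eq [CompleteSpace X] {x y : X} (h : T.HasOrbitDeriv x y) {t : ℝ}
    (ht : 0 ≤ t) : ∫ s in (0 : ℝ)..t, T.op s.toNNReal y = T.op t.toNNReal x - x := by
  rw [intervalIntegral.integral_eq_sub_of_hasDeriv_right_of_le ht
    (T.continuous_orbit x).continuousOn (fun s hs => h.hasDerivWithinAt hs.1.le)
    ((T.continuous_orbit y).intervalIntegrable _ _)]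
  simp [T.op_zero]

theorem HasOrbitDeriv.op_apply_eq [CompleteSpace X] {x : X} (h : T.HasOrbitDeriv x 0) {t : ℝ}
    (ht : 0 ≤ t) : T.op t.toNNReal x = x := by
  have := h.integral_eq ht
  simp only [map_zero, intervalIntegral.integral_zero] at this
  exact (sub_eq_zero.1 this.symm)

theorem hasOrbitDeriv_of_neg_eq_generator {A : X →ₗ.[ℂ] X} (hA : -A = T.generator)
    (x : A.domain) : T.HasOrbitDeriv x (-A x) := by
  rw [← mem_graph_generator, ← hA, LinearPMap.mem_graph_iff]
  exact ⟨x, rfl, rfl⟩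

theorem HasOrbitDeriv.mem_domain {A : X →ₗ.[ℂ] X} (hA : -A = T.generator) {x y : X}
    (h : T.HasOrbitDeriv x y) : ∃ hx : x ∈ A.domain, A ⟨x, hx⟩ = -y := by
  rw [← mem_graph_generator, ← hA, LinearPMap.mem_graph_iff] at h
  obtain ⟨x', hx', h'⟩ := h
  simp only at hx' h'
  subst hx'
  exact ⟨x'.2, by rw [← h']; exact (neg_neg _).symm⟩

section DiffKernel

variable (T) in
/-- The operator `∫ k_t(s) T(s)x ds` for the kernel `k_t(s) = p(s) - p(s - t)`,
`p(s) = s^(-α)`. -/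
def diffOp (α t : ℝ) (x : X) : X := densityIntegral (diffKernel α t) fun s => T.op s x

variable {α : ℝ} (hα : α ∈ Set.Ioo (0 : ℝ) 1)
include hα

theorem diffOp_eq (hT : T.IsBounded) {t : ℝ} (ht : 0 ≤ t) (x : X) :
    T.diffOp α t x = T.densityOp hT (integrable_diffKernel hα ht) x := rfl

theorem norm_diffOp_le {M : ℝ} (hM : ∀ s, ‖T.op s‖ ≤ M) {t : ℝ} (ht : 0 ≤ t) (x : X) :
    ‖T.diffOp α t x‖ ≤ (M * (2 * t ^ (1 - α) / (1 - α))) * ‖x‖ := by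
  rw [← integral_abs_diffKernel hα ht]
  exact norm_densityIntegral_le hM (integrable_diffKernel hα ht) x

/-- It suffices to compare images under the injective `μ̂(A)`. There `μ̂(A) C_t x = C_t ν̂(A) u =
ν̂(A) C_t u`, and the transform identity `μ̂ z^α · (1 - e^(-tz))/(tz) = μ̂ · k̂_t/(tΓ(1-α))`
finishes. -/
theorem cesaro_eq_diffOp [CompleteSpace X] (hT : T.IsBounded) {μ ν : ComplexMeasure ℝ≥0}
    (hr : T.IsRegularizer (fun z : ℂ => z ^ (α : ℂ)) μ ν) {x u : X}
    (hu : T.hillePhillips ν u = T.hillePhillips μ x) {t : ℝ} (ht : 0 < t) :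
    T.cesaro t x = (t * Real.Gamma (1 - α))⁻¹ • T.diffOp α t u := by
  have hΓ : Real.Gamma (1 - α) ≠ 0 := (Real.Gamma_pos_of_pos (by linarith [hα.2])).ne'
  have hk : Integrable fun s => (t * Real.Gamma (1 - α))⁻¹ * diffKernel α t s :=
    (integrable_diffKernel hα ht.le).const_mul _
  have h1 : (t * Real.Gamma (1 - α))⁻¹ • T.diffOp α t u = T.densityOp hT hk u := by
    rw [diffOp, densityIntegral, densityOp_apply, ← integral_smul]
    simp only [smul_smul]
  rw [h1]
  refine hr.injective ?_
  rw [cesaro_eq_densityOp (hT := hT) ht.le, ← apply_hillePhillips (hT := hT)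
    (fun s => commute_densityOp_op _ s), ← hu, apply_hillePhillips (hT := hT)
    (fun s => commute_densityOp_op _ s)]
  refine hillePhillips_densityOp_eq _ _ (fun z hz => ?_) u
  have h2 : densityIntegral (fun s => (t * Real.Gamma (1 - α))⁻¹ * diffKernel α t s)
      (fun s : ℝ≥0 => Real.exp (-(z * s))) = z ^ α * ((1 - Real.exp (-(t * z))) / (t * z)) := by
    have h3 := densityIntegral_diffKernel hα ht hz
    rw [densityIntegral] at h3 ⊢
    simp only [smul_eq_mul, mul_assoc] at h3 ⊢
    rw [integral_const_mul, h3, Real.rpow_sub hz, Real.rpow_one]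
    field_simp
  rw [hr.laplace_eq z (by simpa using hz), h2, densityIntegral_cesaroKernel ht hz, mul_assoc,
    Complex.ofReal_mul, Complex.ofReal_cpow hz.le]

omit hα in
theorem rpow_mul_inv_mul {t c : ℝ} (ht : 0 < t) :
    t ^ α * (t * c)⁻¹ = c⁻¹ * t ^ (α - 1) := by
  rw [Real.rpow_sub ht, Real.rpow_one, mul_inv]
  field_simp

theorem isBigO_cesaro [CompleteSpace X] (hT : T.IsBounded) {x : X}
    (hx : x ∈ T.fractionalPowerRange α) :
    (fun t : ℝ => ‖T.cesaro t x‖) =O[atTop] fun t : ℝ => t ^ (-α) := by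
  obtain ⟨u, μ, ν, hr, hu⟩ := hx
  obtain ⟨M, hM⟩ := id hT
  have hΓ : 0 < Real.Gamma (1 - α) := Real.Gamma_pos_of_pos (by linarith [hα.2])
  refine IsBigO.of_bound ((Real.Gamma (1 - α))⁻¹ * (M * (2 / (1 - α)) * ‖u‖)) ?_
  filter_upwards [eventually_gt_atTop 0] with t ht
  rw [norm_norm, cesaro_eq_diffOp hα hT hr hu ht, norm_smul, norm_inv,
    Real.norm_of_nonneg (by positivity), Real.norm_of_nonneg (Real.rpow_nonneg ht.le _)]
  calc (t * Real.Gamma (1 - α))⁻¹ * ‖T.diffOp α t u‖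
      ≤ (t * Real.Gamma (1 - α))⁻¹ * ((M * (2 * t ^ (1 - α) / (1 - α))) * ‖u‖) := by
        gcongr
        exact norm_diffOp_le hα hM ht.le u
    _ = _ := by
        rw [show (1 : ℝ) - α = 1 + -α by ring, Real.rpow_add ht, Real.rpow_one]
        field_simp

omit hα in
theorem diffOp_op {t δ : ℝ} (ht : 0 ≤ t) (hδ : 0 ≤ δ) (x : X) :
    T.diffOp α t (T.op δ.toNNReal x) =
      ∫ s : ℝ, diffKernel α t (s - δ) • T.op s.toNNReal x := by
  rw [diffOp, densityIntegral,
    ← integral_add_right_eq_self (fun s : ℝ => diffKernel α t (s - δ) • T.op s.toNNReal x) δ]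
  congr 1
  funext s
  rw [add_sub_cancel_right]
  rcases le_or_gt s 0 with hs | hs
  · simp [diffKernel_of_nonpos ht hs]
  · rw [op_toNNReal_add hs.le hδ]

theorem diffOp_sub_op (hT : T.IsBounded) {t δ : ℝ} (ht : 0 ≤ t) (hδ : 0 ≤ δ) (x : X) :
    T.diffOp α t (x - T.op δ.toNNReal x) =
      ∫ s : ℝ, (diffKernel α t s - diffKernel α t (s - δ)) • T.op s.toNNReal x := by
  have h := integrable_density_smul_op hT (integrable_diffKernel hα ht) x
  have h' := integrable_density_smul_op hT ((integrable_diffKernel hα ht).comp_sub_right δ) x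
  simp only [sub_smul]
  rw [integral_sub h h', ← diffOp_op ht hδ]
  simp only [diffOp_eq hα hT ht, map_sub]
  rfl

theorem diffOp_sub_op_comm (hT : T.IsBounded) {t δ : ℝ} (ht : 0 ≤ t) (hδ : 0 ≤ δ) (x : X) :
    T.diffOp α t (x - T.op δ.toNNReal x) = T.diffOp α δ (x - T.op t.toNNReal x) := by
  rw [diffOp_sub_op hα hT ht hδ, diffOp_sub_op hα hT hδ ht]
  simp only [diffKernel_sub_shift α t δ]

variable (T α) in
/-- The vectors `x` for which the normalized operators `t^(α-1) ∫ k_t(s) T(s)x ds` tend to `0`. -/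
def diffOpNull : Set X := {x | Tendsto (fun t : ℝ => t ^ (α - 1) • T.diffOp α t x) atTop (𝓝 0)}

theorem norm_rpow_smul_diffOp_le {M : ℝ} (hM : ∀ s, ‖T.op s‖ ≤ M) {t : ℝ} (ht : 0 < t) (x : X) :
    ‖t ^ (α - 1) • T.diffOp α t x‖ ≤ M * (2 / (1 - α)) * ‖x‖ := by
  rw [norm_smul, Real.norm_of_nonneg (Real.rpow_nonneg ht.le _)]
  calc t ^ (α - 1) * ‖T.diffOp α t x‖
      ≤ t ^ (α - 1) * ((M * (2 * t ^ (1 - α) / (1 - α))) * ‖x‖) := by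
        gcongr
        exact norm_diffOp_le hα hM ht.le x
    _ = (t ^ (α - 1) * t ^ (1 - α)) * (M * (2 / (1 - α)) * ‖x‖) := by ring
    _ = _ := by
        rw [← Real.rpow_add ht, sub_add_sub_cancel, sub_self, Real.rpow_zero, one_mul]

/-- The normalized operators are bounded uniformly in `t`, so strong convergence to `0` passes to
limits of vectors. -/
theorem isClosed_diffOpNull (hT : T.IsBounded) : IsClosed (T.diffOpNull α) := by
  obtain ⟨M, hM⟩ := id hT
  have hM0 := nonneg_of_norm_op_le hM
  have h1α : 0 < 1 - α := by linarith [hα.2]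
  refine isClosed_of_closure_subset fun x hx => ?_
  rw [diffOpNull, Set.mem_ofPred_eq, NormedAddGroup.tendsto_nhds_zero]
  intro ε hε
  set C := M * (2 / (1 - α)) with hC
  have hC0 : 0 ≤ C := by positivity
  obtain ⟨y, hy, hxy⟩ := Metric.mem_closure_iff.1 hx (ε / 2 / (C + 1)) (by positivity)
  rw [diffOpNull, Set.mem_ofPred_eq, NormedAddGroup.tendsto_nhds_zero] at hy
  filter_upwards [hy (ε / 2) (by positivity), eventually_gt_atTop 0] with t ht ht0
  have h1 : t ^ (α - 1) • T.diffOp α t x =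
      t ^ (α - 1) • T.diffOp α t (x - y) + t ^ (α - 1) • T.diffOp α t y := by
    simp only [diffOp_eq hα hT ht0.le, map_sub, smul_sub, sub_add_cancel]
  have h2 : ‖t ^ (α - 1) • T.diffOp α t (x - y)‖ ≤ ε / 2 := by
    refine (norm_rpow_smul_diffOp_le hα hM ht0 _).trans ?_
    rw [dist_eq_norm, lt_div_iff₀ (by positivity)] at hxy
    nlinarith [norm_nonneg (x - y)]
  rw [h1]
  exact (norm_add_le _ _).trans_lt (by linarith)

theorem add_mem_diffOpNull (hT : T.IsBounded) {x y : X} (hx : x ∈ T.diffOpNull α)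
    (hy : y ∈ T.diffOpNull α) : x + y ∈ T.diffOpNull α := by
  have h := Tendsto.add hx hy
  rw [add_zero] at h
  refine h.congr' ?_
  filter_upwards [eventually_gt_atTop 0] with t ht
  simp only [diffOp_eq hα hT ht.le, map_add, smul_add]

/-- After `t` and `δ` are exchanged by `diffOp_sub_op_comm`, the integral is bounded independently
of `t`, and the factor `t^(α-1)` tends to `0`. -/
theorem sub_op_mem_diffOpNull (hT : T.IsBounded) {δ : ℝ} (hδ : 0 ≤ δ) (x : X) (c : ℝ) :
    c • (x - T.op δ.toNNReal x) ∈ T.diffOpNull α := by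
  obtain ⟨M, hM⟩ := id hT
  have hM0 := nonneg_of_norm_op_le hM
  have h1α : 0 < 1 - α := by linarith [hα.2]
  set K := |c| * ((M * (2 * δ ^ (1 - α) / (1 - α))) * (‖x‖ + M * ‖x‖)) with hK
  have hlim : Tendsto (fun t : ℝ => t ^ (α - 1) * K) atTop (𝓝 0) := by
    have := (tendsto_rpow_neg_atTop h1α).mul_const K
    rwa [zero_mul, neg_sub] at this
  refine squeeze_zero_norm' ?_ hlim
  filter_upwards [eventually_gt_atTop 0] with t ht
  rw [norm_smul, Real.norm_of_nonneg (Real.rpow_nonneg ht.le _)]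
  refine mul_le_mul_of_nonneg_left ?_ (Real.rpow_nonneg ht.le _)
  have h1 : T.diffOp α t (c • (x - T.op δ.toNNReal x)) =
      c • T.diffOp α δ (x - T.op t.toNNReal x) := by
    rw [← diffOp_sub_op_comm hα hT ht.le hδ]
    simp only [diffOp_eq hα hT ht.le, ContinuousLinearMap.map_smul_of_tower]
  rw [h1, norm_smul, Real.norm_eq_abs]
  refine mul_le_mul_of_nonneg_left ?_ (abs_nonneg c)
  refine (norm_diffOp_le hα hM hδ _).trans ?_
  gcongr
  exact (norm_sub_le _ _).trans (by gcongr; exact norm_op_apply_le hM x _)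

/-- Here `y = Ax` is the limit of `δ⁻¹(x - T(δ)x)`, which lie in the closed set. -/
theorem mem_diffOpNull_of_hasOrbitDeriv (hT : T.IsBounded) {x y : X} (h : T.HasOrbitDeriv x (-y)) :
    y ∈ T.diffOpNull α := by
  have h1 := h.neg
  rw [neg_neg] at h1
  refine (isClosed_diffOpNull hα hT).mem_of_tendsto h1 ?_
  filter_upwards [self_mem_nhdsWithin] with δ hδ
  rw [← smul_neg, neg_sub]
  exact sub_op_mem_diffOpNull hα hT (le_of_lt hδ) x _

/-- The orbit is constant and `k_t` has integral zero. -/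
theorem mem_diffOpNull_of_hasOrbitDeriv_zero [CompleteSpace X] {x : X} (h : T.HasOrbitDeriv x 0) :
    x ∈ T.diffOpNull α := by
  refine tendsto_const_nhds.congr' ?_
  filter_upwards [eventually_gt_atTop 0] with t ht
  have h1 : ∀ s : ℝ, diffKernel α t s • T.op s.toNNReal x = diffKernel α t s • x := by
    intro s
    rcases le_or_gt s 0 with hs | hs
    · simp [diffKernel_of_nonpos ht.le hs]
    · rw [h.op_apply_eq hs.le]
  rw [diffOp, densityIntegral]
  simp only [h1]
  rw [integral_smul_const, integral_diffKernel hα ht.le, zero_smul, smul_zero]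

theorem diffOpNull_eq_univ [CompleteSpace X] (hT : T.IsBounded) {A : X →ₗ.[ℂ] X}
    (hA : -A = T.generator) (hE : A.IsMeanErgodic) (x : X) : x ∈ T.diffOpNull α := by
  have hx : x ∈ A.kernel ⊔ (LinearMap.range A.toFun).topologicalClosure := by
    rw [hE.codisjoint.eq_top]
    trivial
  obtain ⟨a, ha, b, hb, rfl⟩ := Submodule.mem_sup.1 hx
  refine add_mem_diffOpNull hα hT ?_ ?_
  · obtain ⟨w, hw, rfl⟩ := ha
    have h := hasOrbitDeriv_of_neg_eq_generator hA w
    have h0 : A w = 0 := hw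
    rw [h0, neg_zero] at h
    exact mem_diffOpNull_of_hasOrbitDeriv_zero hα h
  · refine closure_minimal ?_ (isClosed_diffOpNull hα hT) hb
    rintro _ ⟨w, rfl⟩
    exact mem_diffOpNull_of_hasOrbitDeriv hα hT (hasOrbitDeriv_of_neg_eq_generator hA w)

theorem isLittleO_cesaro [CompleteSpace X] (hT : T.IsBounded) {A : X →ₗ.[ℂ] X}
    (hA : -A = T.generator) (hE : A.IsMeanErgodic) {x : X}
    (hx : x ∈ T.fractionalPowerRange α) :
    (fun t : ℝ => ‖T.cesaro t x‖) =o[atTop] fun t : ℝ => t ^ (-α) := by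
  obtain ⟨u, μ, ν, hr, hu⟩ := hx
  have hΓ : 0 < Real.Gamma (1 - α) := Real.Gamma_pos_of_pos (by linarith [hα.2])
  rw [isLittleO_iff_tendsto' (by
    filter_upwards [eventually_gt_atTop 0] with t ht h
    exact absurd h (Real.rpow_pos_of_pos ht _).ne')]
  have h1 := (Tendsto.norm (diffOpNull_eq_univ hα hT hA hE u)).const_mul (Real.Gamma (1 - α))⁻¹
  rw [norm_zero, mul_zero] at h1
  refine h1.congr' ?_
  filter_upwards [eventually_gt_atTop 0] with t ht
  rw [cesaro_eq_diffOp hα hT hr hu ht, norm_smul, norm_smul, norm_inv,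
    Real.norm_of_nonneg (Real.rpow_nonneg ht.le _),
    Real.norm_of_nonneg (by positivity : 0 ≤ t * Real.Gamma (1 - α)),
    Real.rpow_neg ht.le, div_inv_eq_mul, mul_right_comm, mul_comm _ (t ^ α),
    rpow_mul_inv_mul ht, mul_assoc]

end DiffKernel

end C0Semigroup

/-! ### Spectral inclusion: the algebra of pairs and its basic elements. -/

namespace C0Semigroup

variable {X : Type*} [NormedAddCommGroup X] [NormedSpace ℂ X] {T : C0Semigroup X}

theorem hasOrbitDeriv_zero : T.HasOrbitDeriv 0 0 := by
  simp [HasOrbitDeriv]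

theorem HasOrbitDeriv.unique {x y y' : X} (h : T.HasOrbitDeriv x y) (h' : T.HasOrbitDeriv x y') :
    y = y' := tendsto_nhds_unique h h'

theorem HasOrbitDeriv.congr {x y x' y' : X} (h : T.HasOrbitDeriv x y) (hx : x = x') (hy : y = y') :
    T.HasOrbitDeriv x' y' := by
  rw [← hx, ← hy]
  exact h

theorem HasOrbitDeriv.map {x y : X} (h : T.HasOrbitDeriv x y) {S : X →L[ℂ] X}
    (hS : ∀ s, Commute S (T.op s)) : T.HasOrbitDeriv (S x) (S y) := by
  refine ((S.continuous.tendsto y).comp h).congr fun t => ?_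
  rw [Function.comp_apply, ContinuousLinearMap.map_smul_of_tower, map_sub]
  congr 2
  exact congrArg (fun L : X →L[ℂ] X => L x) (hS t.toNNReal)

theorem hasOrbitDeriv_of_hasDerivAt {φ : ℝ → X} {y : X} (h : HasDerivAt φ y 0)
    (hφ : ∀ t, 0 < t → T.op t.toNNReal (φ 0) = φ t) : T.HasOrbitDeriv (φ 0) y := by
  have h1 := h.hasDerivWithinAt (s := Set.Ioi 0)
  rw [hasDerivWithinAt_iff_tendsto_slope' (by simp)] at h1
  refine h1.congr' ?_
  filter_upwards [self_mem_nhdsWithin] with t ht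
  rw [slope, vsub_eq_sub, sub_zero, hφ t ht]

/-- The algebra of pairs `(g, G)` for which `g - G = (z - A) B` for a bounded operator `B`, where
`-A` generates `T` and `G` and `B` commute with the semigroup. -/
def spectralAlgebra (T : C0Semigroup X) (z : ℂ) : Subalgebra ℂ (ℂ × (X →L[ℂ] X)) where
  carrier := {p | (∀ s, Commute p.2 (T.op s)) ∧ ∃ B : X →L[ℂ] X, (∀ s, Commute B (T.op s)) ∧
    ∀ x, T.HasOrbitDeriv (B x) (p.1 • x - p.2 x - z • B x)}
  mul_mem' := by
    rintro ⟨g, G⟩ ⟨g', G'⟩ ⟨hG, B, hB, h⟩ ⟨hG', B', hB', h'⟩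
    refine ⟨fun s => (hG s).mul_left (hG' s), g' • B + G * B', fun s =>
      ((hB s).smul_left g').add_left ((hG s).mul_left (hB' s)), fun x => ?_⟩
    refine (((h x).smul g').add ((h' x).map hG)).congr rfl ?_
    change g' • (g • x - G x - z • B x) + G (g' • x - G' x - z • B' x) =
      (g * g') • x - G (G' x) - z • (g' • B x + G (B' x))
    simp only [map_sub, map_smul, smul_sub, smul_add, mul_smul, smul_comm g' g, smul_comm g' z]
    abel
  add_mem' := by
    rintro ⟨g, G⟩ ⟨g', G'⟩ ⟨hG, B, hB, h⟩ ⟨hG', B', hB', h'⟩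
    refine ⟨fun s => (hG s).add_left (hG' s), B + B', fun s => (hB s).add_left (hB' s),
      fun x => ?_⟩
    refine ((h x).add (h' x)).congr rfl ?_
    change g • x - G x - z • B x + (g' • x - G' x - z • B' x) =
      (g + g') • x - (G x + G' x) - z • (B x + B' x)
    simp only [smul_add, add_smul]
    abel
  algebraMap_mem' c := by
    refine ⟨fun s => Algebra.commutes c _, 0, fun s => Commute.zero_left _, fun x => ?_⟩
    refine hasOrbitDeriv_zero.congr rfl ?_
    change 0 = c • x - c • x - z • (0 : X)
    simp

/-- If `‖G‖ < |g|`, then `g - G = (z - A)B` is invertible, and `B (g - G)⁻¹` is a bounded two-sided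
inverse of `z - A`. -/
theorem norm_fst_le_of_mem_spectralAlgebra [CompleteSpace X] {A : X →ₗ.[ℂ] X}
    (hA : -A = T.generator) {z : ℂ} (hz : z ∈ A.unboundedSpectrum) {p : ℂ × (X →L[ℂ] X)}
    (hp : p ∈ T.spectralAlgebra z) : ‖p.1‖ ≤ ‖p.2‖ := by
  obtain ⟨g, G⟩ := p
  obtain ⟨hG, B, hB, h⟩ := hp
  simp only at hG h ⊢
  by_contra! hlt
  apply hz
  have hu : IsUnit (algebraMap ℂ (X →L[ℂ] X) g - G) := by
    refine spectrum.mem_resolventSet_of_norm_lt_mul (lt_of_le_of_lt ?_ hlt)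
    exact mul_le_of_le_one_right (norm_nonneg _) ContinuousLinearMap.norm_id_le
  obtain ⟨u, hu⟩ := hu
  set K : X →L[ℂ] X := ↑u⁻¹ with hK
  have hH : ∀ x, (u : X →L[ℂ] X) x = g • x - G x := fun x => by
    rw [hu, Algebra.algebraMap_eq_smul_one]; rfl
  have h1 : ∀ x, (u : X →L[ℂ] X) (K x) = x := fun x =>
    congrArg (fun L : X →L[ℂ] X => L x) u.mul_inv
  have h2 : ∀ x, K ((u : X →L[ℂ] X) x) = x := fun x =>
    congrArg (fun L : X →L[ℂ] X => L x) u.inv_mul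
  have h3 : ∀ x, T.HasOrbitDeriv (B (K x)) (x - z • B (K x)) := fun x => by
    have := h (K x)
    rwa [← hH, h1] at this
  refine ⟨B * K, fun x => ?_, fun x => ?_⟩
  · obtain ⟨hx, h4⟩ := (h3 x).mem_domain hA
    refine ⟨hx, ?_⟩
    erw [h4]
    simp
  · have h4 := hasOrbitDeriv_of_neg_eq_generator hA x
    set y := z • (x : X) - A x with hy
    have h5 : T.HasOrbitDeriv (B (K y) - x) (-(z • (B (K y) - x))) := by
      have := (h3 y).add (h4.smul (-1))
      convert this using 1
      · simp [sub_eq_add_neg]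
      · simp only [hy, neg_smul, one_smul, smul_sub, neg_neg, neg_sub]
        abel
    set d := B (K y) - x with hd
    -- The defect `d` of the left inverse satisfies `(z - A)d = 0`. Computing the orbit derivative
    -- of `B d` in two ways gives `(g - G)d = 0`, hence `d = 0`.
    have h6 := (h5.map hB).unique (h d)
    rw [map_neg, map_smul, ← hH, eq_sub_iff_add_eq, neg_add_cancel] at h6
    have h7 : d = 0 := by rw [← h2 d, ← h6, map_zero]
    exact sub_eq_zero.1 h7

theorem norm_fst_le_of_mem_closure [CompleteSpace X] {A : X →ₗ.[ℂ] X}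
    (hA : -A = T.generator) {z : ℂ} (hz : z ∈ A.unboundedSpectrum) {p : ℂ × (X →L[ℂ] X)}
    (hp : p ∈ (T.spectralAlgebra z).topologicalClosure) : ‖p.1‖ ≤ ‖p.2‖ := by
  refine closure_minimal (t := {p : ℂ × (X →L[ℂ] X) | ‖p.1‖ ≤ ‖p.2‖})
    (fun q hq => norm_fst_le_of_mem_spectralAlgebra hA hz hq) ?_ hp
  exact isClosed_le (by fun_prop) (by fun_prop)

section

variable [CompleteSpace X]

omit [CompleteSpace X] in
theorem intervalIntegrable_exp_smul_op (z : ℂ) (x : X) (a b : ℝ) :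
    IntervalIntegrable (fun s : ℝ => Complex.exp (s * z) • T.op s.toNNReal x) volume a b := by
  refine Continuous.intervalIntegrable ?_ _ _
  exact (by fun_prop : Continuous fun s : ℝ => Complex.exp (s * z)).smul (T.continuous_orbit x)

/-- The right side is differentiable in `h` by the fundamental theorem of calculus, which shows that
the integral lies in the domain of the generator and computes its image. -/
theorem op_integral_exp_smul_op (z : ℂ) (x : X) {t h : ℝ} (ht : 0 ≤ t) (hh : 0 ≤ h) :
    T.op h.toNNReal (∫ s in (0 : ℝ)..t, Complex.exp (s * z) • T.op s.toNNReal x) =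
      Complex.exp (-(h * z)) • ((∫ s in (0 : ℝ)..(t + h), Complex.exp (s * z) • T.op s.toNNReal x) -
        ∫ s in (0 : ℝ)..h, Complex.exp (s * z) • T.op s.toNNReal x) := by
  rw [intervalIntegral.integral_interval_sub_left (intervalIntegrable_exp_smul_op z x _ _)
    (intervalIntegrable_exp_smul_op z x _ _),
    ← ContinuousLinearMap.intervalIntegral_comp_comm _ (intervalIntegrable_exp_smul_op z x _ _),
    ← intervalIntegral.integral_smul]
  have h1 := intervalIntegral.integral_comp_add_right (a := 0) (b := t)
    (fun s : ℝ => Complex.exp (-(h * z)) • Complex.exp (s * z) • T.op s.toNNReal x) h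
  rw [zero_add] at h1
  rw [← h1]
  refine intervalIntegral.integral_congr fun s hs => ?_
  rw [Set.uIcc_of_le ht] at hs
  rw [smul_smul, ← Complex.exp_add, map_smul, add_comm s h, op_toNNReal_add hh hs.1]
  congr 2
  push_cast
  ring

theorem hasDerivAt_integral_exp_smul_op (z : ℂ) (x : X) (t : ℝ) :
    HasDerivAt (fun u => ∫ s in (0 : ℝ)..u, Complex.exp (s * z) • T.op s.toNNReal x)
      (Complex.exp (t * z) • T.op t.toNNReal x) t := by
  have hc : Continuous fun s : ℝ => Complex.exp (s * z) • T.op s.toNNReal x :=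
    (by fun_prop : Continuous fun s : ℝ => Complex.exp (s * z)).smul (T.continuous_orbit x)
  exact (hc.integral_hasStrictDerivAt 0 t).hasDerivAt

theorem hasDerivAt_exp_neg_mul (z : ℂ) (c : ℝ) :
    HasDerivAt (fun h : ℝ => Complex.exp (-((h : ℂ) * z))) (-z * Complex.exp (-((c : ℂ) * z))) c := by
  have h1 : HasDerivAt (fun h : ℝ => -((h : ℂ) * z)) (-(((1 : ℝ) : ℂ) * z)) c :=
    ((hasDerivAt_id c).ofReal_comp.mul_const z).neg
  refine h1.cexp.congr_deriv ?_
  rw [Complex.ofReal_one, one_mul, mul_comm]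

theorem hasOrbitDeriv_integral_exp_smul_op (z : ℂ) (x : X) {t : ℝ} (ht : 0 ≤ t) :
    T.HasOrbitDeriv (∫ s in (0 : ℝ)..t, Complex.exp (s * z) • T.op s.toNNReal x)
      (Complex.exp (t * z) • T.op t.toNNReal x - x -
        z • ∫ s in (0 : ℝ)..t, Complex.exp (s * z) • T.op s.toNNReal x) := by
  set V : ℝ → X := fun u => ∫ s in (0 : ℝ)..u, Complex.exp (s * z) • T.op s.toNNReal x with hV
  have hV0 : V 0 = 0 := intervalIntegral.integral_same
  have h1 : HasDerivAt (fun h : ℝ => Complex.exp (-(h * z)) • (V (t + h) - V h))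
      (Complex.exp (t * z) • T.op t.toNNReal x - x - z • V t) 0 := by
    have e1 := hasDerivAt_integral_exp_smul_op (T := T) z x (t + 0)
    have e2 : HasDerivAt (fun h => V (t + h)) _ 0 := e1.comp_const_add t 0
    have e3 := hasDerivAt_integral_exp_smul_op (T := T) z x 0
    have e4 := (hasDerivAt_exp_neg_mul z 0).smul (e2.sub e3)
    refine HasDerivAt.congr_deriv e4 ?_
    simp [T.op_zero]
    abel
  have h2 := hasOrbitDeriv_of_hasDerivAt (T := T) h1 fun h hh => by
    have := op_integral_exp_smul_op (T := T) z x ht hh.le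
    simpa [hV0] using this
  simpa [hV0] using h2

/-- The bounded operator `x ↦ ∫₀ᵗ e^{sz} T(s)x ds`. -/
def expIntegralOp (hT : T.IsBounded) (z : ℂ) (t : ℝ) : X →L[ℂ] X :=
  LinearMap.mkContinuous
    { toFun := fun x => ∫ s in (0 : ℝ)..t, Complex.exp (s * z) • T.op s.toNNReal x
      map_add' := fun x y => by
        simp only [map_add, smul_add]
        exact intervalIntegral.integral_add (intervalIntegrable_exp_smul_op z x _ _)
          (intervalIntegrable_exp_smul_op z y _ _)
      map_smul' := fun c x => by
        simp only [map_smul, RingHom.id_apply]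
        rw [← intervalIntegral.integral_smul]
        simp only [smul_comm c] }
    (Real.exp (|t| * ‖z‖) * hT.choose * |t - 0|) fun x => by
      have h1 : ∀ s ∈ Set.uIoc 0 t, ‖Complex.exp (s * z) • T.op s.toNNReal x‖ ≤
          Real.exp (|t| * ‖z‖) * hT.choose * ‖x‖ := by
        intro s hs
        rw [norm_smul, mul_assoc]
        gcongr
        · refine (Complex.norm_exp_le_exp_norm _).trans (Real.exp_le_exp.2 ?_)
          rw [norm_mul, Complex.norm_real, Real.norm_eq_abs]
          refine mul_le_mul_of_nonneg_right ?_ (norm_nonneg z)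
          rcases Set.mem_uIoc.1 hs with h | h
          · rw [abs_of_pos h.1]; exact h.2.trans (le_abs_self t)
          · rw [abs_of_nonpos h.2, abs_of_neg (h.1.trans_le h.2)]; linarith [h.1]
        · exact norm_op_apply_le hT.choose_spec x _
      refine (intervalIntegral.norm_integral_le_of_norm_le_const h1).trans (le_of_eq ?_)
      ring

omit [CompleteSpace X] in
theorem expIntegralOp_apply (hT : T.IsBounded) (z : ℂ) (t : ℝ) (x : X) :
    expIntegralOp hT z t x = ∫ s in (0 : ℝ)..t, Complex.exp (s * z) • T.op s.toNNReal x := rfl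

theorem commute_expIntegralOp (hT : T.IsBounded) (z : ℂ) (t : ℝ) (s : ℝ≥0) :
    Commute (expIntegralOp hT z t) (T.op s) := by
  ext x
  change expIntegralOp hT z t (T.op s x) = T.op s (expIntegralOp hT z t x)
  rw [expIntegralOp_apply, expIntegralOp_apply,
    ← ContinuousLinearMap.intervalIntegral_comp_comm _ (intervalIntegrable_exp_smul_op z x _ _)]
  congr 1
  funext r
  rw [map_smul]
  congr 1
  exact congrArg (fun L : X →L[ℂ] X => L x) (T.op_comm r.toNNReal s)

/-- The factor is `B = -e^(-tz) ∫₀ᵗ e^(sz) T(s) ds`. -/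
theorem exp_op_mem_spectralAlgebra (hT : T.IsBounded) (z : ℂ) (t : ℝ≥0) :
    (Complex.exp (-((t : ℝ) : ℂ) * z), T.op t) ∈ T.spectralAlgebra z := by
  refine ⟨fun s => T.op_comm t s, (-Complex.exp (-((t : ℝ) : ℂ) * z)) • expIntegralOp hT z t,
    fun s => (commute_expIntegralOp hT z t s).smul_left _, fun x => ?_⟩
  have h := (hasOrbitDeriv_integral_exp_smul_op (T := T) z x t.2).smul
    (-Complex.exp (-((t : ℝ) : ℂ) * z))
  refine h.congr rfl ?_
  have h1 : Complex.exp (-((t : ℝ) : ℂ) * z) * Complex.exp (((t : ℝ) : ℂ) * z) = 1 := by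
    rw [← Complex.exp_add, neg_mul, neg_add_cancel, Complex.exp_zero]
  have h2 : T.op (t : ℝ).toNNReal x = T.op t x := by rw [Real.toNNReal_coe]
  set I := ∫ s in (0 : ℝ)..t, Complex.exp (s * z) • T.op s.toNNReal x with hI
  change -Complex.exp (-((t : ℝ) : ℂ) * z) •
      (Complex.exp (((t : ℝ) : ℂ) * z) • T.op (t : ℝ).toNNReal x - x - z • I) =
    Complex.exp (-((t : ℝ) : ℂ) * z) • x - T.op t x - z • -Complex.exp (-((t : ℝ) : ℂ) * z) • I
  rw [smul_comm z, smul_sub, smul_sub, smul_smul, neg_mul, h1, h2]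
  simp only [neg_smul, one_smul]
  abel

theorem re_nonneg_of_mem_unboundedSpectrum (hT : T.IsBounded) {A : X →ₗ.[ℂ] X}
    (hA : -A = T.generator) {z : ℂ} (hz : z ∈ A.unboundedSpectrum) : 0 ≤ z.re := by
  obtain ⟨M, hM⟩ := id hT
  by_contra! hneg
  have h1 : ∀ t : ℝ, 0 ≤ t → Real.exp (-(t * z.re)) ≤ M := fun t ht => by
    have := norm_fst_le_of_mem_spectralAlgebra hA hz (exp_op_mem_spectralAlgebra hT z ⟨t, ht⟩)
    simp only [Complex.norm_exp] at this
    refine le_trans (le_of_eq ?_) (this.trans (hM _))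
    rw [neg_mul, Complex.neg_re, Complex.re_ofReal_mul]
    rfl
  -- This `t` makes the exponent equal to `M`, and `e^M ≤ M` is impossible.
  have h2 := h1 (M / -z.re) (div_nonneg (nonneg_of_norm_op_le hM) (by linarith))
  have h3 := Real.add_one_le_exp (-(M / -z.re * z.re))
  have h4 : -(M / -z.re * z.re) = M := by
    rw [div_neg, neg_mul, neg_neg, div_mul_cancel₀ _ hneg.ne]
  rw [h4] at h2 h3
  linarith

/-- The density `e^(-s)` on `(0, ∞)`. -/
def _root_.expKernel : ℝ → ℝ := (Set.Ioi (0 : ℝ)).indicator fun s => Real.exp (-s)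

omit [CompleteSpace X] in
theorem _root_.integrable_expKernel : Integrable expKernel :=
  (integrable_indicator_iff measurableSet_Ioi).2 (by
    simpa using integrableOn_exp_neg_Ioi 0)

variable (T) in
/-- The resolvent `(1 + A)⁻¹ = ∫₀^∞ e^(-s) T(s) ds`. -/
def resolventOp (hT : T.IsBounded) : X →L[ℂ] X := T.densityOp hT integrable_expKernel

/-- Shifting the integral gives `T(h)Rx = e^h (Rx - ∫₀ʰ e^(-s) T(s)x ds)`, which is differentiable
at `h = 0`. -/
theorem hasOrbitDeriv_resolventOp (hT : T.IsBounded) (x : X) :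
    T.HasOrbitDeriv (T.resolventOp hT x) (T.resolventOp hT x - x) := by
  set V : ℝ → X := fun u => ∫ s in (0 : ℝ)..u, Complex.exp (s * (-1)) • T.op s.toNNReal x with hV
  have hV0 : V 0 = 0 := intervalIntegral.integral_same
  have hR : T.resolventOp hT x =
      ∫ s in Set.Ioi (0 : ℝ), Complex.exp (s * (-1)) • T.op s.toNNReal x := by
    rw [resolventOp, densityOp_apply, ← integral_indicator measurableSet_Ioi]
    congr 1
    funext s
    by_cases hs : 0 < s
    · simp [expKernel, hs, ← Complex.ofReal_neg, ← Complex.ofReal_exp]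
    · simp [expKernel, hs]
  have hI : IntegrableOn (fun s : ℝ => Complex.exp (s * (-1)) • T.op s.toNNReal x)
      (Set.Ioi 0) := by
    rw [← integrable_indicator_iff measurableSet_Ioi]
    refine (integrable_density_smul_op hT integrable_expKernel x).congr (ae_of_all _ fun s => ?_)
    by_cases hs : 0 < s
    · simp [expKernel, hs, ← Complex.ofReal_neg, ← Complex.ofReal_exp]
    · simp [expKernel, hs]
  have h0 : HasDerivAt (fun h : ℝ => Complex.exp (-(h * (-1))) • (T.resolventOp hT x - V h))
      (T.resolventOp hT x - x) 0 := by
    have e3 := hasDerivAt_integral_exp_smul_op (T := T) (-1) x 0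
    have e4 := (hasDerivAt_exp_neg_mul (-1) 0).smul (e3.const_sub (T.resolventOp hT x))
    refine HasDerivAt.congr_deriv e4 ?_
    simp [T.op_zero]
    abel
  have h2 := hasOrbitDeriv_of_hasDerivAt (T := T) h0 fun h hh => by
    simp only [hV0, Complex.ofReal_zero, zero_mul, neg_zero, Complex.exp_zero, sub_zero, one_smul]
    have e1 : T.resolventOp hT x - V h =
        ∫ s in Set.Ioi h, Complex.exp (s * (-1)) • T.op s.toNNReal x := by
      rw [hR, sub_eq_iff_eq_add', hV]
      exact (intervalIntegral.integral_interval_add_Ioi hI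
        (hI.mono_set (Set.Ioi_subset_Ioi hh.le))).symm
    have e2 := (measurePreserving_add_right volume h).setIntegral_preimage_emb
      (measurableEmbedding_addRight h)
      (fun s : ℝ => Complex.exp (-(h * (-1))) • Complex.exp (s * (-1)) • T.op s.toNNReal x)
      (Set.Ioi h)
    have e3 : (fun s : ℝ => s + h) ⁻¹' Set.Ioi h = Set.Ioi 0 := by
      ext s
      simp
    rw [e3] at e2
    rw [e1, hR, ← ContinuousLinearMap.integral_comp_comm _ hI, ← integral_smul, ← e2]
    refine setIntegral_congr_fun measurableSet_Ioi fun s hs => ?_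
    rw [map_smul, smul_smul, ← Complex.exp_add, add_comm s h, op_toNNReal_add hh.le (le_of_lt hs)]
    congr 2
    push_cast
    ring
  simpa [hV0] using h2

end

end C0Semigroup

/-! ### Spectral inclusion for integrals, through the closure of the algebra. -/

theorem Submodule.integral_mem {E Ω : Type*} [NormedAddCommGroup E] [NormedSpace ℝ E]
    [CompleteSpace E] [MeasurableSpace Ω] {m : Measure Ω} {S : Submodule ℝ E}
    (hS : IsClosed (S : Set E)) {f : Ω → E} (hf : Integrable f m) (h : ∀ s, f s ∈ S) :
    ∫ s, f s ∂m ∈ S := by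
  have := hS
  have h1 := S.mkQL.integral_comp_comm hf
  have h2 : ∀ s, S.mkQL (f s) = 0 := fun s => (Submodule.Quotient.mk_eq_zero S).2 (h s)
  simp only [h2, integral_zero] at h1
  exact (Submodule.Quotient.mk_eq_zero S).1 h1.symm

theorem one_add_ne_zero_of_re_nonneg {z : ℂ} (hz : 0 ≤ z.re) : 1 + z ≠ 0 := fun h => by
  have := congrArg Complex.re h
  simp only [Complex.add_re, Complex.one_re, Complex.zero_re] at this
  linarith

namespace C0Semigroup

variable {X : Type*} [NormedAddCommGroup X] [NormedSpace ℂ X] [CompleteSpace X] {T : C0Semigroup X}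

theorem commute_resolventOp (hT : T.IsBounded) (s : ℝ≥0) :
    Commute (T.resolventOp hT) (T.op s) := commute_densityOp_op _ s

/-- Resolvent identity: `(1 + z)⁻¹ - R = (z - A)B` with `B = -(1 + z)⁻¹ R`. -/
theorem resolventOp_mem_spectralAlgebra (hT : T.IsBounded) {z : ℂ} (hz : 0 ≤ z.re) :
    ((1 + z)⁻¹, T.resolventOp hT) ∈ T.spectralAlgebra z := by
  refine ⟨commute_resolventOp hT, (-(1 + z)⁻¹) • T.resolventOp hT,
    fun s => (commute_resolventOp hT s).smul_left _, fun x => ?_⟩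
  refine ((hasOrbitDeriv_resolventOp hT x).smul (-(1 + z)⁻¹)).congr rfl ?_
  change -(1 + z)⁻¹ • (T.resolventOp hT x - x) =
    (1 + z)⁻¹ • x - T.resolventOp hT x - z • (-(1 + z)⁻¹ • T.resolventOp hT x)
  have h1 : z * (1 + z)⁻¹ = 1 - (1 + z)⁻¹ := by
    field_simp [one_add_ne_zero_of_re_nonneg hz]
    ring
  rw [smul_smul, mul_neg, h1]
  simp only [neg_smul, smul_sub, sub_smul, one_smul]
  abel

theorem norm_op_mul_resolventOp_sub_le {M : ℝ} (hM : ∀ s, ‖T.op s‖ ≤ M) (hT : T.IsBounded)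
    (s : ℝ≥0) : ‖T.op s * T.resolventOp hT - T.resolventOp hT‖ ≤
      M * ‖T.resolventOp hT - 1‖ * s := by
  have hM0 := nonneg_of_norm_op_le hM
  refine ContinuousLinearMap.opNorm_le_bound _ (by positivity) fun x => ?_
  have h1 := (hasOrbitDeriv_resolventOp hT x).integral_eq s.2
  have h2 := intervalIntegral.norm_integral_le_of_norm_le_const (a := (0 : ℝ)) (b := s)
    (f := fun r : ℝ => T.op r.toNNReal (T.resolventOp hT x - x))
    (C := M * (‖T.resolventOp hT - 1‖ * ‖x‖)) fun r _ => by
      refine (norm_op_apply_le hM _ _).trans (mul_le_mul_of_nonneg_left ?_ hM0)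
      exact (T.resolventOp hT - 1).le_opNorm x
  change ‖T.op s (T.resolventOp hT x) - T.resolventOp hT x‖ ≤ _
  have h3 : T.op (s : ℝ).toNNReal = T.op s := by rw [Real.toNNReal_coe]
  erw [h1] at h2
  erw [h3] at h2
  refine h2.trans (le_of_eq ?_)
  rw [sub_zero, NNReal.abs_eq]
  ring

/-- `T` is only strongly continuous; the factor `R` maps into the domain of `A` and makes the family
Lipschitz in operator norm. This is why resolvents accompany every operator in the spectral
inclusion. -/
theorem continuous_op_mul_resolventOp (hT : T.IsBounded) :
    Continuous fun s : ℝ≥0 => T.op s * T.resolventOp hT := by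
  obtain ⟨M, hM⟩ := id hT
  have hM0 := nonneg_of_norm_op_le hM
  have key : ∀ r h : ℝ≥0, ‖T.op (r + h) * T.resolventOp hT - T.op r * T.resolventOp hT‖ ≤
      M * (M * ‖T.resolventOp hT - 1‖) * h := fun r h => by
    rw [T.op_add, mul_assoc, ← mul_sub, mul_assoc M]
    exact (norm_mul_le _ _).trans (mul_le_mul (hM r) (norm_op_mul_resolventOp_sub_le hM hT h)
      (norm_nonneg _) hM0)
  refine (LipschitzWith.of_dist_le_mul (K := ⟨M * (M * ‖T.resolventOp hT - 1‖), by positivity⟩)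
    fun s r => ?_).continuous
  rw [NNReal.dist_eq]
  rcases le_total r s with hrs | hrs
  · obtain ⟨h, rfl⟩ := exists_add_of_le hrs
    rw [dist_eq_norm]
    refine (key r h).trans (le_of_eq ?_)
    push_cast
    rw [add_sub_cancel_left, NNReal.abs_eq]
    rfl
  · obtain ⟨h, rfl⟩ := exists_add_of_le hrs
    rw [dist_comm, dist_eq_norm, abs_sub_comm]
    refine (key s h).trans (le_of_eq ?_)
    push_cast
    rw [add_sub_cancel_left, NNReal.abs_eq]
    rfl

/-- The pair is the Bochner integral, in `ℂ × (X →L[ℂ] X)`, of `h(s)` times products of elements of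
the algebra. -/
theorem densityOp_mul_resolventOp_mem_closure (hT : T.IsBounded) {z : ℂ} (hz : 0 ≤ z.re)
    {h : ℝ → ℝ} (hh : Integrable h) :
    (densityIntegral h (fun s : ℝ≥0 => Complex.exp (-((s : ℝ) : ℂ) * z)) * (1 + z)⁻¹,
      T.densityOp hT hh * T.resolventOp hT) ∈ (T.spectralAlgebra z).topologicalClosure := by
  obtain ⟨M, hM⟩ := id hT
  have hM0 := nonneg_of_norm_op_le hM
  set R := T.resolventOp hT with hR
  set F : ℝ≥0 → ℂ × (X →L[ℂ] X) := fun s =>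
    (Complex.exp (-((s : ℝ) : ℂ) * z) * (1 + z)⁻¹, T.op s * R) with hF
  have hFc : Continuous F := by
    refine Continuous.prodMk (by fun_prop) (continuous_op_mul_resolventOp hT)
  have hFb : ∀ s, ‖F s‖ ≤ max ‖(1 + z)⁻¹‖ (M * ‖R‖) := fun s => by
    refine max_le_max ?_ ?_
    · rw [norm_mul]
      exact mul_le_of_le_one_left (norm_nonneg _) (norm_cexp_neg_mul_le s hz)
    · exact (norm_mul_le _ _).trans (mul_le_mul_of_nonneg_right (hM s) (norm_nonneg _))
  have hI := integrable_smul_comp_toNNReal hh hFc hFb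
  have h1 : densityIntegral h F ∈
      ((T.spectralAlgebra z).topologicalClosure.toSubmodule.restrictScalars ℝ) := by
    refine Submodule.integral_mem (Subalgebra.isClosed_topologicalClosure _) hI fun s => ?_
    refine Submodule.smul_mem _ _ ?_
    exact Subalgebra.le_topologicalClosure _ (mul_mem (exp_op_mem_spectralAlgebra hT z _)
      (resolventOp_mem_spectralAlgebra hT hz))
  have h2 : densityIntegral h F =
      (densityIntegral h (fun s : ℝ≥0 => Complex.exp (-((s : ℝ) : ℂ) * z)) * (1 + z)⁻¹,
        T.densityOp hT hh * R) := by
    refine Prod.ext ?_ ?_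
    · rw [densityIntegral, fst_integral hI, densityIntegral, ← integral_mul_const]
      refine integral_congr_ae (ae_of_all _ fun s => ?_)
      exact (smul_mul_assoc _ _ _).symm
    · rw [densityIntegral, snd_integral hI]
      ext x
      rw [ContinuousLinearMap.integral_apply hI.snd]
      rfl
  rw [← h2]
  exact h1

theorem norm_densityIntegral_mul_le {A : X →ₗ.[ℂ] X} (hT : T.IsBounded) (hA : -A = T.generator)
    {z : ℂ} (hz : z ∈ A.unboundedSpectrum) {h₁ h₂ : ℝ → ℝ} (hh₁ : Integrable h₁)
    (hh₂ : Integrable h₂) :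
    ‖densityIntegral h₁ (fun s : ℝ≥0 => Complex.exp (-((s : ℝ) : ℂ) * z)) * (1 + z)⁻¹ *
      (densityIntegral h₂ (fun s : ℝ≥0 => Complex.exp (-((s : ℝ) : ℂ) * z)) * (1 + z)⁻¹)‖ ≤
    ‖T.densityOp hT hh₁ * T.resolventOp hT * (T.densityOp hT hh₂ * T.resolventOp hT)‖ := by
  have hre := re_nonneg_of_mem_unboundedSpectrum hT hA hz
  exact norm_fst_le_of_mem_closure hA hz (mul_mem
    (densityOp_mul_resolventOp_mem_closure hT hre hh₁)
    (densityOp_mul_resolventOp_mem_closure hT hre hh₂))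

theorem exists_complexMeasure_of_density (hT : T.IsBounded) {h : ℝ → ℝ} (hh : Integrable h) :
    ∃ μ : ComplexMeasure ℝ≥0, (∀ x, T.hillePhillips μ x = T.densityOp hT hh x) ∧
      ∀ z : ℂ, 0 ≤ z.re → laplaceTransform μ z =
        densityIntegral h fun s : ℝ≥0 => Complex.exp (-((s : ℝ) : ℂ) * z) := by
  have := isFiniteMeasure_posPartMeasure hh
  have := isFiniteMeasure_posPartMeasure hh.neg
  obtain ⟨M, hM⟩ := id hT
  refine ⟨_, fun x => (hillePhillips_eq (hT := hT) (posPartMeasure h) (posPartMeasure (-h)) 0 0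
    x).trans ?_, fun z hz => (laplaceTransform_eq _ _ _ _ hz).trans ?_⟩
  · rw [integral_posPartMeasure_sub hh (T.strongly_continuous x) (norm_op_apply_le hM x)]
    simp [densityOp_apply, densityIntegral]
  · rw [integral_posPartMeasure_sub hh (by fun_prop) fun s => norm_cexp_neg_mul_le s hz]
    simp

theorem injective_resolventOp (hT : T.IsBounded) : Function.Injective (T.resolventOp hT) := by
  refine (injective_iff_map_eq_zero _).2 fun x hx => ?_
  have h := hasOrbitDeriv_resolventOp hT x
  rw [hx] at h
  simpa using h.unique hasOrbitDeriv_zero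

end C0Semigroup

/-! ### Laplace transforms of the kernels used in part (c). -/

theorem expKernel_of_nonpos {s : ℝ} (hs : s ≤ 0) : expKernel s = 0 :=
  Set.indicator_of_notMem (by simpa using hs) _

theorem expKernel_of_pos {s : ℝ} (hs : 0 < s) : expKernel s = Real.exp (-s) :=
  Set.indicator_of_mem (Set.mem_Ioi.2 hs) _

theorem expKernel_nonneg (s : ℝ) : 0 ≤ expKernel s :=
  Set.indicator_nonneg (fun _ _ => (Real.exp_pos _).le) s

theorem densityIntegral_expKernel {z : ℂ} (hz : 0 ≤ z.re) :
    densityIntegral expKernel (fun s : ℝ≥0 => Complex.exp (-((s : ℝ) : ℂ) * z)) = (1 + z)⁻¹ := by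
  have h1 : (-(1 + z)).re < 0 := by
    simp only [Complex.neg_re, Complex.add_re, Complex.one_re]
    linarith
  have h2 := integral_exp_mul_complex_Ioi h1 0
  rw [Complex.ofReal_zero, mul_zero, Complex.exp_zero, neg_div_neg_eq, one_div] at h2
  rw [densityIntegral, ← h2, ← integral_indicator measurableSet_Ioi]
  congr 1
  funext s
  rcases le_or_gt s 0 with hs | hs
  · rw [expKernel_of_nonpos hs, zero_smul, Set.indicator_of_notMem (by simpa using hs)]
  · rw [expKernel_of_pos hs, Set.indicator_of_mem (Set.mem_Ioi.2 hs), Real.coe_toNNReal _ hs.le,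
      Complex.real_smul, Complex.ofReal_exp, ← Complex.exp_add]
    congr 1
    push_cast
    ring

section

variable {α : ℝ} (hα : α ∈ Set.Ioo (0 : ℝ) 1)
include hα

theorem integrable_expKernel_mul_diffKernel :
    Integrable fun q : ℝ × ℝ => expKernel q.1 * diffKernel α q.1 q.2 := by
  have hm : Measurable expKernel :=
    (Real.measurable_exp.comp measurable_neg).indicator measurableSet_Ioi
  have hm' : Measurable fun q : ℝ × ℝ => expKernel q.1 * diffKernel α q.1 q.2 :=
    (hm.comp measurable_fst).mul (measurable_diffKernel α)
  rw [Measure.volume_eq_prod]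
  refine (integrable_prod_iff hm'.aestronglyMeasurable).2 ⟨ae_of_all _ fun t => ?_, ?_⟩
  · rcases le_or_gt t 0 with ht | ht
    · simp [expKernel_of_nonpos ht]
    · exact (integrable_diffKernel hα ht.le).const_mul (expKernel t)
  · have h1 := ((Real.GammaIntegral_convergent (s := 2 - α) (by linarith [hα.2])).mul_const
      (2 / (1 - α)))
    refine ((integrable_indicator_iff measurableSet_Ioi).2 h1).congr (ae_of_all _ fun t => ?_)
    rcases le_or_gt t 0 with ht | ht
    · simp [expKernel_of_nonpos ht, ht]
    · simp only [norm_mul, Real.norm_eq_abs]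
      rw [Set.indicator_of_mem (Set.mem_Ioi.2 ht), integral_const_mul,
        integral_abs_diffKernel hα ht.le, abs_of_nonneg (expKernel_nonneg t), expKernel_of_pos ht,
        show 2 - α - 1 = 1 - α by ring]
      ring

/-- The density on `(0, ∞)` whose Laplace transform is `z^α / (1 + z)`. -/
def fracKernel (α s : ℝ) : ℝ := (Real.Gamma (1 - α))⁻¹ * ∫ t, expKernel t * diffKernel α t s

theorem integrable_fracKernel : Integrable (fracKernel α) := by
  have h := (integrable_expKernel_mul_diffKernel hα).integral_prod_right
  exact h.const_mul _

/-- Averaging `z^(α-1)(1 - e^(-tz))` against `e^(-t) dt` gives `z^(α-1) · z/(1 + z)`, by Fubini. -/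
theorem densityIntegral_fracKernel_of_pos {z : ℂ} (hz : 0 < z.re) :
    densityIntegral (fracKernel α) (fun s : ℝ≥0 => Complex.exp (-((s : ℝ) : ℂ) * z)) =
      z ^ (α : ℂ) * (1 + z)⁻¹ := by
  have hz0 : z ≠ 0 := fun h => by simp [h] at hz
  have hG : (Real.Gamma (1 - α) : ℂ) ≠ 0 :=
    Complex.ofReal_ne_zero.2 (Real.Gamma_pos_of_pos (by linarith [hα.2])).ne'
  have h1 : ∀ s : ℝ, fracKernel α s • Complex.exp (-((s.toNNReal : ℝ) : ℂ) * z) =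
      (Real.Gamma (1 - α) : ℂ)⁻¹ * ∫ t : ℝ, (expKernel t * diffKernel α t s) •
        Complex.exp (-((s.toNNReal : ℝ) : ℂ) * z) := fun s => by
    rw [integral_smul_const, fracKernel, mul_smul, Complex.real_smul, Complex.ofReal_inv]
  have hI : Integrable (fun q : ℝ × ℝ => (expKernel q.2 * diffKernel α q.2 q.1) •
      Complex.exp (-((q.1.toNNReal : ℝ) : ℂ) * z)) (volume.prod volume) := by
    refine (integrable_expKernel_mul_diffKernel hα).swap.smul_bdd 1 ?_ (ae_of_all _ fun q =>
      norm_cexp_neg_mul_le _ hz.le)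
    refine Continuous.aestronglyMeasurable ?_
    have : Continuous fun q : ℝ × ℝ => (q.1.toNNReal : ℝ) := by fun_prop
    fun_prop
  have h2 : ∀ t : ℝ, ∫ s : ℝ, (expKernel t * diffKernel α t s) •
      Complex.exp (-((s.toNNReal : ℝ) : ℂ) * z) =
      z ^ ((α : ℂ) - 1) * Real.Gamma (1 - α) *
        (expKernel t • (1 - Complex.exp (-((t.toNNReal : ℝ) : ℂ) * z))) := fun t => by
    rcases le_or_gt t 0 with ht | ht
    · simp [expKernel_of_nonpos ht]
    · rw [mul_smul_comm, Real.coe_toNNReal _ ht.le, ← integral_diffKernel_mul_cexp hα hz,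
        ← integral_smul]
      congr 1
      funext s
      rcases le_or_gt s 0 with hs | hs
      · simp [diffKernel_of_nonpos ht.le hs]
      · rw [Real.coe_toNNReal _ hs.le, mul_smul, Complex.real_smul (x := diffKernel α t s)]
  have h3 : ∫ t : ℝ, expKernel t • (1 - Complex.exp (-((t.toNNReal : ℝ) : ℂ) * z)) =
      1 - (1 + z)⁻¹ := by
    have e1 := densityIntegral_expKernel (z := 0) le_rfl
    have e2 := densityIntegral_expKernel hz.le
    simp only [mul_zero, Complex.exp_zero, add_zero, inv_one] at e1
    simp only [smul_sub]
    rw [integral_sub]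
    · exact congrArg₂ _ e1 e2
    · exact integrable_expKernel.smul_const _
    · exact integrable_smul_comp_toNNReal integrable_expKernel
        (F := fun t : ℝ≥0 => Complex.exp (-((t : ℝ) : ℂ) * z)) (by fun_prop)
        fun s => norm_cexp_neg_mul_le s hz.le
  rw [densityIntegral]
  simp only [h1]
  rw [integral_const_mul, integral_integral_swap hI]
  simp only [h2]
  rw [integral_const_mul, h3, Complex.cpow_sub _ _ hz0, Complex.cpow_one]
  field_simp [one_add_ne_zero_of_re_nonneg hz.le]
  ring

/-- The spectrum may meet the imaginary axis, so the formula is extended there by letting `r ↓ 0` in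
`z + r`. -/
theorem densityIntegral_fracKernel {z : ℂ} (hz : 0 ≤ z.re) (hz0 : z ≠ 0) :
    densityIntegral (fracKernel α) (fun s : ℝ≥0 => Complex.exp (-((s : ℝ) : ℂ) * z)) =
      z ^ (α : ℂ) * (1 + z)⁻¹ := by
  have hw : Tendsto (fun r : ℝ => z + r) (𝓝[>] 0) (𝓝 z) := by
    have : Continuous fun r : ℝ => z + r := by fun_prop
    simpa using (this.tendsto 0).mono_left nhdsWithin_le_nhds
  have hs : z ∈ Complex.slitPlane := by
    rw [Complex.mem_slitPlane_iff]
    by_contra! h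
    exact hz0 (Complex.ext (le_antisymm h.1 hz) h.2)
  have h1 : Tendsto (fun r : ℝ => (z + r) ^ (α : ℂ) * (1 + (z + r))⁻¹) (𝓝[>] 0)
      (𝓝 (z ^ (α : ℂ) * (1 + z)⁻¹)) :=
    ((continuousAt_cpow_const hs).tendsto.comp hw).mul
      ((tendsto_const_nhds.add hw).inv₀ (one_add_ne_zero_of_re_nonneg hz))
  have h2 : Tendsto (fun r : ℝ => densityIntegral (fracKernel α)
      fun s : ℝ≥0 => Complex.exp (-((s : ℝ) : ℂ) * (z + r))) (𝓝[>] 0)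
      (𝓝 (densityIntegral (fracKernel α) fun s : ℝ≥0 => Complex.exp (-((s : ℝ) : ℂ) * z))) := by
    have hv := integrable_fracKernel hα
    have hre : ∀ r : ℝ, 0 < r → 0 ≤ (z + r).re := fun r hr => by
      rw [Complex.add_re, Complex.ofReal_re]
      linarith
    refine tendsto_integral_filter_of_dominated_convergence (fun s => ‖fracKernel α s‖) ?_ ?_
      hv.norm (ae_of_all _ fun s => ?_)
    · filter_upwards [self_mem_nhdsWithin] with r hr
      exact (integrable_smul_comp_toNNReal hv
        (F := fun s : ℝ≥0 => Complex.exp (-((s : ℝ) : ℂ) * (z + r))) (by fun_prop)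
        fun s => norm_cexp_neg_mul_le s (hre r hr)).1
    · filter_upwards [self_mem_nhdsWithin] with r hr
      refine ae_of_all _ fun s => ?_
      rw [norm_smul]
      exact mul_le_of_le_one_right (norm_nonneg _) (norm_cexp_neg_mul_le _ (hre r hr))
    · exact ((hw.const_mul _).cexp).const_smul _
  refine tendsto_nhds_unique h2 (h1.congr' ?_)
  filter_upwards [self_mem_nhdsWithin] with r hr
  refine (densityIntegral_fracKernel_of_pos hα ?_).symm
  rw [Complex.add_re, Complex.ofReal_re]
  linarith [Set.mem_Ioi.1 hr]

end

theorem densityIntegral_cesaroKernel_cexp {t : ℝ} (ht : 0 < t) {z : ℂ} (hz : z ≠ 0) :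
    densityIntegral (cesaroKernel t) (fun s : ℝ≥0 => Complex.exp (-((s : ℝ) : ℂ) * z)) =
      (1 - Complex.exp (-(t * z))) / (t * z) := by
  have h1 := integral_exp_mul_complex (a := 0) (b := t) (neg_ne_zero.2 hz)
  have h2 : densityIntegral (cesaroKernel t)
      (fun s : ℝ≥0 => Complex.exp (-((s : ℝ) : ℂ) * z)) =
      (t : ℂ)⁻¹ * ∫ s in (0 : ℝ)..t, Complex.exp (-z * s) := by
    rw [densityIntegral, intervalIntegral.integral_of_le ht.le, ← integral_const_mul,
      ← integral_indicator measurableSet_Ioc]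
    congr 1
    funext s
    by_cases hs : s ∈ Set.Ioc 0 t
    · rw [cesaroKernel, Set.indicator_of_mem hs, Set.indicator_of_mem hs,
        Real.coe_toNNReal _ hs.1.le, Complex.real_smul, Complex.ofReal_inv, neg_mul, neg_mul,
        mul_comm z]
    · simp [cesaroKernel, hs]
  have ht' : (t : ℂ) ≠ 0 := Complex.ofReal_ne_zero.2 ht.ne'
  rw [h2, h1, Complex.ofReal_zero, mul_zero, Complex.exp_zero, neg_mul, mul_comm z]
  field_simp
  ring

/-- `|1 - e^(-w)| ≥ |w| - |w|² = 1/4`. -/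
theorem half_le_norm_one_sub_cexp_div {w : ℂ} (hw : ‖w‖ = 1 / 2) :
    1 / 2 ≤ ‖(1 - Complex.exp (-w)) / w‖ := by
  have h1 := Complex.norm_exp_sub_one_sub_id_le (x := -w) (by rw [norm_neg, hw]; norm_num)
  have h2 := norm_add_le (Complex.exp (-w) - 1 - -w) (1 - Complex.exp (-w))
  rw [show Complex.exp (-w) - 1 - -w + (1 - Complex.exp (-w)) = w by ring] at h2
  rw [norm_neg] at h1
  rw [norm_div, hw, le_div_iff₀ (by norm_num)]
  rw [hw] at h1 h2
  linarith

/-! ### Part (c): uniform boundedness against spectral inclusion. -/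

namespace C0Semigroup

variable {X : Type*} [NormedAddCommGroup X] [NormedSpace ℂ X] [CompleteSpace X] {T : C0Semigroup X}
  {α : ℝ}

/-- The regularizer `(1 + z)⁻¹` exhibits the vector as `A^α R x`. -/
theorem densityOp_fracKernel_mem_fractionalPowerRange (hα : α ∈ Set.Ioo (0 : ℝ) 1)
    (hT : T.IsBounded) (x : X) :
    T.densityOp hT (integrable_fracKernel hα) x ∈ T.fractionalPowerRange α := by
  obtain ⟨μ, hμ, hμ'⟩ := exists_complexMeasure_of_density hT integrable_expKernel
  obtain ⟨ν, hν, hν'⟩ := exists_complexMeasure_of_density hT (integrable_fracKernel hα)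
  refine ⟨T.resolventOp hT x, μ, ν, ⟨fun z hz => ?_, ?_⟩, ?_⟩
  · rw [hμ' z hz.le, hν' z hz.le, densityIntegral_expKernel hz.le,
      densityIntegral_fracKernel_of_pos hα hz, mul_comm]
  · rw [show T.hillePhillips μ = T.resolventOp hT from funext hμ]
    exact injective_resolventOp hT
  · change T.hillePhillips ν (T.resolventOp hT x) =
      T.hillePhillips μ (T.densityOp hT (integrable_fracKernel hα) x)
    rw [hν, hμ]
    exact (apply_densityOp (commute_resolventOp hT) _ x).symm

theorem exists_norm_cesaro_mul_le (hα : α ∈ Set.Ioo (0 : ℝ) 1) (hT : T.IsBounded) {ε : ℝ → ℝ}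
    (hε : ∀ t, 0 < t → 0 < ε t)
    (h : ∀ y ∈ T.fractionalPowerRange α,
      BddAbove ((fun t : ℝ => t ^ α * ‖T.cesaro t y‖ / ε t) '' Set.Ici 1)) :
    ∃ C, ∀ t, 1 ≤ t → t ^ α * ‖T.densityOp hT (integrable_cesaroKernel t) * T.resolventOp hT *
      (T.densityOp hT (integrable_fracKernel hα) * T.resolventOp hT)‖ ≤ C * ε t := by
  have hpos : ∀ t : ℝ, 1 ≤ t → 0 < t ^ α / ε t := fun t ht =>
    div_pos (Real.rpow_pos_of_pos (by linarith) _) (hε t (by linarith))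
  obtain ⟨C, hC⟩ := banach_steinhaus (g := fun t : {t : ℝ // 1 ≤ t} => ((t.1 ^ α / ε t : ℝ) : ℂ) •
    (T.densityOp hT (integrable_cesaroKernel t.1) * T.resolventOp hT *
      (T.densityOp hT (integrable_fracKernel hα) * T.resolventOp hT))) fun x => by
    -- The two extra resolvents are those of the spectral inclusion; commuting one past `v(A)` turns
    -- `C_t v(A) R² x` into the stated product.
    obtain ⟨C, hC⟩ := h _ (densityOp_fracKernel_mem_fractionalPowerRange hα hT
      (T.resolventOp hT (T.resolventOp hT x)))
    refine ⟨C, fun ⟨t, ht⟩ => le_trans (le_of_eq ?_) (hC ⟨t, ht, rfl⟩)⟩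
    change ‖((t ^ α / ε t : ℝ) : ℂ) • T.densityOp hT (integrable_cesaroKernel t) _‖ =
      t ^ α * ‖T.cesaro t _‖ / ε t
    rw [cesaro_eq_densityOp (hT := hT) (by linarith),
      ← apply_densityOp (commute_resolventOp hT), norm_smul, Complex.norm_real, Real.norm_of_nonneg (hpos t ht).le, div_mul_eq_mul_div]
    rfl
  refine ⟨C, fun t ht => ?_⟩
  have := hC ⟨t, ht⟩
  rw [norm_smul, Complex.norm_real, Real.norm_of_nonneg (hpos t ht).le, div_mul_eq_mul_div,
    div_le_iff₀ (hε t (by linarith))] at this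
  exact this

theorem le_rpow_mul_norm_cesaro_mul {A : X →ₗ.[ℂ] X} (hα : α ∈ Set.Ioo (0 : ℝ) 1)
    (hT : T.IsBounded) (hA : -A = T.generator) {z : ℂ} (hz : z ∈ A.unboundedSpectrum)
    (hz0 : z ≠ 0) (hz1 : ‖z‖ ≤ 1) {t : ℝ} (ht : t * ‖z‖ = 1 / 2) :
    1 / 32 ≤ t ^ α * ‖T.densityOp hT (integrable_cesaroKernel t) * T.resolventOp hT *
      (T.densityOp hT (integrable_fracKernel hα) * T.resolventOp hT)‖ := by
  have hre := re_nonneg_of_mem_unboundedSpectrum hT hA hz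
  have hzpos := norm_pos_iff.2 hz0
  have htpos : 0 < t := pos_of_mul_pos_left (by rw [ht]; norm_num) hzpos.le
  have h := norm_densityIntegral_mul_le hT hA hz (integrable_cesaroKernel t)
    (integrable_fracKernel hα)
  rw [densityIntegral_cesaroKernel_cexp htpos hz0, densityIntegral_fracKernel hα hre hz0] at h
  refine le_trans ?_ (mul_le_mul_of_nonneg_left h (Real.rpow_nonneg htpos.le α))
  have h1 : 1 / 2 ≤ ‖(1 - Complex.exp (-(t * z))) / (t * z)‖ :=
    half_le_norm_one_sub_cexp_div (by
      rw [norm_mul, Complex.norm_real, Real.norm_of_nonneg htpos.le, ht])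
  have h2 : 1 / 2 ≤ ‖(1 + z)⁻¹‖ := by
    rw [norm_inv, one_div]
    refine inv_anti₀ (norm_pos_iff.2 (one_add_ne_zero_of_re_nonneg hre)) ?_
    refine (norm_add_le _ _).trans ?_
    rw [norm_one]
    linarith
  have h3 : 1 / 2 ≤ t ^ α * ‖z ^ (α : ℂ)‖ := by
    rw [Complex.norm_cpow_real, ← Real.mul_rpow htpos.le hzpos.le, ht]
    exact Real.self_le_rpow_of_le_one (by norm_num) (by norm_num) hα.2.le
  simp only [norm_mul] at *
  set a := ‖(1 + z)⁻¹‖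
  set b := ‖(1 - Complex.exp (-(t * z))) / (t * z)‖
  set c := t ^ α * ‖z ^ (α : ℂ)‖ with hc
  -- Five factors of size at least `1/2`: the Cesàro symbol, `t^α |z^α|`, and three copies of `|1 +
  -- z|⁻¹`, one of them from the symbol of `fracKernel`.
  calc (1 / 32 : ℝ) = 1 / 2 * (1 / 2) * (1 / 2 * (1 / 2) * (1 / 2)) := by norm_num
    _ ≤ b * a * (c * a * a) := by gcongr
    _ = t ^ α * (b * a * (‖z ^ (α : ℂ)‖ * a * a)) := by rw [hc]; ring

theorem exists_not_bddAbove_cesaro {A : X →ₗ.[ℂ] X} (hα : α ∈ Set.Ioo (0 : ℝ) 1)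
    (hT : T.IsBounded) (hA : -A = T.generator) (h0 : AccPt (0 : ℂ) (𝓟 A.unboundedSpectrum))
    {ε : ℝ → ℝ} (hε : ∀ t, 0 < t → 0 < ε t) (hlim : Tendsto ε atTop (𝓝 0)) :
    ∃ y ∈ T.fractionalPowerRange α,
      ¬ BddAbove ((fun t : ℝ => t ^ α * ‖T.cesaro t y‖ / ε t) '' Set.Ici 1) := by
  by_contra! hcon
  obtain ⟨C, hC⟩ := exists_norm_cesaro_mul_le hα hT hε hcon
  have h1 : ∀ᶠ t in atTop, C * ε t < 1 / 32 :=
    (by simpa using hlim.const_mul C : Tendsto (fun t => C * ε t) atTop (𝓝 0)).eventually_lt_const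
      (by norm_num)
  obtain ⟨t₀, ht₀⟩ := eventually_atTop.1 h1
  set t₁ := max t₀ 1 with ht₁
  have ht₁pos : 0 < t₁ := lt_of_lt_of_le one_pos (le_max_right _ _)
  -- The radius is chosen so that `t = 1/(2|z|)` is at least `t₁`, where `C ε(t) < 1/32`.
  obtain ⟨z, ⟨hzball, hz⟩, hz0⟩ := accPt_iff_nhds.1 h0 (Metric.ball 0 (1 / (2 * t₁)))
    (Metric.ball_mem_nhds _ (by positivity))
  rw [mem_ball_zero_iff, lt_div_iff₀ (by positivity)] at hzball
  have hzpos := norm_pos_iff.2 hz0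
  have ht : t₁ ≤ 1 / (2 * ‖z‖) := by
    rw [le_div_iff₀ (by positivity)]
    linarith
  have hz1 : ‖z‖ ≤ 1 := by
    have := mul_le_mul_of_nonneg_left (le_max_right t₀ 1) hzpos.le
    rw [← ht₁] at this
    linarith
  have h2 := le_rpow_mul_norm_cesaro_mul hα hT hA hz hz0 hz1 (t := 1 / (2 * ‖z‖)) (by field_simp)
  have h3 := hC _ ((le_max_right _ _).trans ht)
  have h4 := ht₀ _ ((le_max_left _ _).trans ht)
  linarith

end C0Semigroup

end

theorem mainTheorem6 {X : Type*} [NormedAddCommGroup X] [NormedSpace ℂ X] [CompleteSpace X]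
    (T : C0Semigroup X) (hT : T.IsBounded) (A : X →ₗ.[ℂ] X) (hA : -A = T.generator)
    (α : ℝ) (hα : α ∈ Set.Ioo (0 : ℝ) 1) :
    (∀ x ∈ T.fractionalPowerRange α,
      (fun t : ℝ => ‖T.cesaro t x‖) =O[atTop] fun t : ℝ => t ^ (-α)) ∧
    (A.IsMeanErgodic → ∀ x ∈ T.fractionalPowerRange α,
      (fun t : ℝ => ‖T.cesaro t x‖) =o[atTop] fun t : ℝ => t ^ (-α)) ∧
    (AccPt (0 : ℂ) (𝓟 A.unboundedSpectrum) →
      ∀ ε : ℝ → ℝ, (∀ t, 0 < t → 0 < ε t) → AntitoneOn ε (Set.Ioi 0) →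
        Tendsto ε atTop (𝓝 0) →
        ∃ y ∈ T.fractionalPowerRange α,
          ¬ BddAbove ((fun t : ℝ => t ^ α * ‖T.cesaro t y‖ / ε t) '' Set.Ici 1)) :=
  ⟨fun _ hx => C0Semigroup.isBigO_cesaro hα hT hx,
    fun hE _ hx => C0Semigroup.isLittleO_cesaro hα hT hA hE hx,
    fun h0 _ hε _ hlim => C0Semigroup.exists_not_bddAbove_cesaro hα hT hA h0 hε hlim⟩
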